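/- A mixed graph $G=(V;D,L)$ is a finite loopless graph whose edges are of two kinds, direction edges ($D$) and length edges ($L$); parallel edges are allowed only if they are of different kinds. For $p:V\to\mathbb{R}^2$, the frameworks $(G,p)$ and $(G,q)$ are equivalent if $p(u)-p(v)$ is a scalar multiple of $q(u)-q(v)$ for all $uv\in D$ with $q(u)\ne q(v)$, and $\|p(u)-p(v)\|=\|q(u)-q(v)\|$ for all $uv\in L$; $p$ and $q$ are congruent if $p(u)-p(v)=q(u)-q(v)$ for all $u,v\in V$, or $p(u)-p(v)=q(v)-q(u)$ for all $u,v\in V$. The framework $(G,p)$ is rigid if for some $\varepsilon>0$ every $q$ such that $(G,q)$ is equivalent to $(G,p)$ and $\|p(v)-q(v)\|<\varepsilon$ for all $v\in V$ is congruent to $p$, and it is redundantly rigid if $(G-e,p)$ is rigid for every edge $e\in D\cup L$. Call $p$ generic if its $2|V|$ coordinates are algebraically independent over $\mathbb{Q}$. The graph $G$ is redundantly rigid if some (equivalently, every) generic $(G,p)$ is. The rigidity matrix $R(G,p)$ has one row for each edge and two columns for each vertex; with $p(u)-p(v)=(a,b)$, the row of $uv\in L$ has entries $(a,b)$ at $u$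 and $(-a,-b)$ at $v$, the row of $uv\in D$ has entries $(b,-a)$ at $u$ and $(-b,a)$ at $v$, and all other entries are $0$. The rigidity matroid $M(G)$ is the matroid on $D\cup L$ of linear independence of the rows of $R(G,p)$ for generic $p$ (it does not depend on the choice of the generic $p$). $G$ is $M$-connected if $M(G)$ is connected, i.e. any two edges of $G$ lie in a common circuit of $M(G)$. $G$ is direction irreducible if (R1) no $e\in D$ belongs to a circuit of $M(G)$ that consists of direction edges only, and (R2) there is no proper induced subgraph $H$ of $G$ (on a non-empty vertex set different from $V$) such that the multigraph $G/H$, obtained by contracting $H$ to a single vertex (deleting the edges of $H$ and keeping all other edges), has only direction edges and is the union of two edge-disjoint spanning trees. $G$ is $2$-connected if $|V|\ge 3$, $G$ is connected, and $G-v$ is connected for every $v\in V$. $G$ is direction-balanced if, whenever $H_1,H_2$ are subgraphs with $G=H_1\cup H_2$, $V(H_1)\cap V(H_2)=\{u,v\}$ with $u\neq v$, and $V(H_1)\setminus V(H_2)\ne\emptyset\ne V(H_2)\setminus V(H_1)$, both $H_1$ and $H_2$ contain a direction edge of $G$ distinct from $uv$. **Lemma.** Let $G=(V;D,L)$ be a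 direction irreducible, $2$-connected, direction-balanced mixed graph with $D\neq\emptyset$. Then $G$ is $M$-connected if and only if $G$ is redundantly rigid. -/

import Mathlib

/-- A mixed graph `G = (V; D, L)` without loops. There is at most one direction edge and at most
one length edge between two vertices; a direction edge may be parallel to a length edge. -/
@[ext] structure MixedGraph (V : Type*) where
  /-- the direction edges -/
  D : SimpleGraph V
  /-- the length edges -/
  L : SimpleGraph V

/-- Labels of potential edges of a mixed graph on `V`: `Sum.inl s(u, v)` is the direction edge `uv`
and `Sum.inr s(u, v)` is the length edge `uv`. -/
abbrev MixedEdge (V : Type*) := Sym2 V ⊕ Sym2 V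

/-- The plane, with its Euclidean norm. -/
abbrev Plane := EuclideanSpace ℝ (Fin 2)

namespace MixedEdge

/-- The unordered pair of end vertices of an edge. -/
def ends {V : Type*} (e : MixedEdge V) : Sym2 V := Sum.elim id id e

/-- `e` is a direction edge. -/
def IsDir {V : Type*} (e : MixedEdge V) : Prop := ∃ s : Sym2 V, e = Sum.inl s

open Classical in
/-- The row of the rigidity matrix at `p` that belongs to an edge. Write `p u - p v = (a, b)`.
A length edge `uv` has entries `(a, b)` at `u` and `(-a, -b)` at `v`; a direction edge `uv` has
entries `(b, -a)` at `u` and `(-b, a)` at `v`; all other entries are zero. (The row does not depend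
on the orientation of the edge.) -/
noncomputable def row {V : Type*} (p : V → Plane) : MixedEdge V → V × Fin 2 → ℝ
  | Sum.inl e => Sym2.lift
      ⟨fun u v x =>
        (if x.1 = u then ![(p u - p v) 1, -(p u - p v) 0] x.2 else 0) +
        (if x.1 = v then ![(p v - p u) 1, -(p v - p u) 0] x.2 else 0),
        fun _ _ => funext fun _ => add_comm _ _⟩ e
  | Sum.inr e => Sym2.lift
      ⟨fun u v x =>
        (if x.1 = u then (p u - p v) x.2 else 0) + (if x.1 = v then (p v - p u) x.2 else 0),
        fun _ _ => funext fun _ => add_comm _ _⟩ e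

end MixedEdge

/-- A multigraph is a tree if it has no loops and no parallel edges and is, as a simple graph,
connected and acyclic. -/
def Graph.IsTree {α β : Type*} (M : Graph α β) : Prop :=
  ∃ _ : M.Simple, M.toSimpleGraph.IsTree

/-- `T` is the edge set of a spanning tree of the multigraph `M`. -/
def Graph.IsSpanningTree {α β : Type*} (M : Graph α β) (T : Set β) : Prop :=
  T ⊆ M.edgeSet ∧ (M.restrict T).IsTree

/-- A matroid is connected if any two elements of its ground set lie in a common circuit. -/
def Matroid.IsConnected {α : Type*} (M : Matroid α) : Prop :=
  ∀ e ∈ M.E, ∀ f ∈ M.E, e ≠ f → ∃ C, M.IsCircuit C ∧ e ∈ C ∧ f ∈ C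

/-- `p` is generic: the coordinates of its points are algebraically independent over `ℚ`. -/
def IsGeneric {V : Type*} (p : V → Plane) : Prop :=
  AlgebraicIndependent ℚ fun x : V × Fin 2 => p x.1 x.2

/-- Generic configurations exist. -/
theorem exists_isGeneric (V : Type*) [Finite V] : ∃ p : V → Plane, IsGeneric p := by
  obtain ⟨s, hs⟩ := exists_isTranscendenceBasis ℚ ℝ
  have hinf : Infinite s := by
    by_contra hfin
    rw [not_infinite_iff_finite] at hfin
    have hcard : Cardinal.mk ℝ ≤ Cardinal.aleph0 := by
      rcases isEmpty_or_nonempty s with he | hne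
      · have halg : Algebra.IsAlgebraic ℚ ℝ := (hs.isEmpty_iff_isAlgebraic).1 he
        simpa using Algebra.IsAlgebraic.cardinalMk_le_max ℚ ℝ
      · have h := hs.lift_cardinalMk_eq_max_lift
        simp only [Cardinal.lift_uzero] at h
        rw [h]
        simp
    exact absurd hcard (not_le.2 (by simp))
  obtain ⟨n, ⟨φ⟩⟩ := Finite.exists_equiv_fin (V × Fin 2)
  let ψ : V × Fin 2 → s := fun x => Infinite.natEmbedding s (φ x)
  have hψ : Function.Injective ψ := fun x y hxy => by
    have := (Infinite.natEmbedding s).injective hxy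
    exact φ.injective (Fin.ext this)
  exact ⟨fun v => WithLp.toLp 2 fun i => (ψ (v, i) : ℝ), hs.1.comp ψ hψ⟩

/-- Two configurations are congruent if they differ by a translation, possibly followed by a
rotation by 180 degrees. -/
def PointCongruent {V : Type*} (p q : V → Plane) : Prop :=
  (∀ u v, p u - p v = q u - q v) ∨ (∀ u v, p u - p v = q v - q u)

namespace MixedGraph

/-- The edge set `D ∪ L`, as a set of labelled edges. -/
def edges {V : Type*} (G : MixedGraph V) : Set (MixedEdge V) :=
  Sum.inl '' G.D.edgeSet ∪ Sum.inr '' G.L.edgeSet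

/-- The graph `G - e`. -/
def deleteEdge {V : Type*} (G : MixedGraph V) (e : MixedEdge V) : MixedGraph V where
  D := G.D.deleteEdges {s | Sum.inl s = e}
  L := G.L.deleteEdges {s | Sum.inr s = e}

/-! ### Rigidity -/

/-- The direction-length frameworks `(G, p)` and `(G, q)` are equivalent. -/
def Equivalent {V : Type*} (G : MixedGraph V) (p q : V → Plane) : Prop :=
  (∀ u v, G.D.Adj u v → q u ≠ q v → ∃ c : ℝ, p u - p v = c • (q u - q v)) ∧
  (∀ u v, G.L.Adj u v → ‖p u - p v‖ = ‖q u - q v‖)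

/-- The framework `(G, p)` is rigid. -/
def FrameworkRigid {V : Type*} (G : MixedGraph V) (p : V → Plane) : Prop :=
  ∃ ε > 0, ∀ q : V → Plane, G.Equivalent p q → (∀ v, ‖p v - q v‖ < ε) → PointCongruent p q

/-- The framework `(G, p)` is redundantly rigid: `(G - e, p)` is rigid for every edge `e`. -/
def FrameworkRedundantlyRigid {V : Type*} (G : MixedGraph V) (p : V → Plane) : Prop :=
  ∀ e ∈ G.edges, (G.deleteEdge e).FrameworkRigid p

/-- The mixed graph `G` is redundantly rigid: some generic realisation of it is. -/
def RedundantlyRigid {V : Type*} (G : MixedGraph V) : Prop :=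
  ∃ p : V → Plane, IsGeneric p ∧ G.FrameworkRedundantlyRigid p

/-! ### The rigidity matroid -/

/-- The rigidity matroid of the framework `(G, p)`: the ground set is the edge set of `G`, and a set
of edges is independent if the corresponding rows of the rigidity matrix are linearly independent. -/
noncomputable def frameworkMatroid {V : Type*} [Finite V] (G : MixedGraph V) (p : V → Plane) :
    Matroid (MixedEdge V) :=
  (IndepMatroid.ofFinite (E := G.edges) (Set.toFinite _)
    (fun I => I ⊆ G.edges ∧ LinearIndepOn ℝ (MixedEdge.row p) I)
    ⟨Set.empty_subset _, linearIndepOn_empty _ _⟩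
    (fun _ _ hJ hIJ => ⟨hIJ.trans hJ.1, hJ.2.mono hIJ⟩)
    (by
      rintro I J ⟨hIE, hI⟩ ⟨hJE, hJ⟩ hlt
      by_contra! hcon
      have hspan : ∀ e ∈ J, MixedEdge.row p e ∈ Submodule.span ℝ (MixedEdge.row p '' I) := by
        intro e he
        by_cases heI : e ∈ I
        · exact Submodule.subset_span ⟨e, heI, rfl⟩
        · by_contra hns
          exact hcon e he heI (Set.insert_subset_iff.2 ⟨hJE he, hIE⟩) (hI.insert hns)
      have hle : Submodule.span ℝ (MixedEdge.row p '' J) ≤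
          Submodule.span ℝ (MixedEdge.row p '' I) := by
        rw [Submodule.span_le]
        rintro _ ⟨e, he, rfl⟩
        exact hspan e he
      have key : ∀ K : Set (MixedEdge V), LinearIndepOn ℝ (MixedEdge.row p) K →
          Module.finrank ℝ (Submodule.span ℝ (MixedEdge.row p '' K)) = K.ncard := by
        intro K hK
        have : Fintype K := Fintype.ofFinite K
        have h := finrank_span_eq_card (R := ℝ) hK
        rw [← Nat.card_coe_set_eq, Nat.card_eq_fintype_card, ← h, Set.image_eq_range]
      have h := Submodule.finrank_mono hle
      rw [key J hJ, key I hI] at h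
      omega)
    (fun _ hI => hI.1)).matroid

/-- The rigidity matroid `M(G)`: the rigidity matroid of a generic realisation of `G`. (All generic
realisations of `G` have the same rigidity matroid.) -/
noncomputable def rigidityMatroid {V : Type*} [Finite V] (G : MixedGraph V) :
    Matroid (MixedEdge V) :=
  G.frameworkMatroid (exists_isGeneric V).choose

/-- `G` is `M`-connected: its rigidity matroid is connected. -/
def MConnected {V : Type*} [Finite V] (G : MixedGraph V) : Prop :=
  G.rigidityMatroid.IsConnected

/-! ### Direction reductions -/

/-- `G`, with its direction and length edges, as a multigraph. -/
def toGraph {V : Type*} (G : MixedGraph V) : Graph V (MixedEdge V) where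
  vertexSet := Set.univ
  edgeSet := G.edges
  IsLink e x y := e ∈ G.edges ∧ e.ends = s(x, y)
  isLink_symm _ _ := ⟨fun _ _ h => ⟨h.1, h.2.trans Sym2.eq_swap⟩⟩
  eq_or_eq_of_isLink_of_isLink _ _ _ _ _ h h' := by
    have := h.2.symm.trans h'.2
    rw [Sym2.eq_iff] at this
    tauto
  edge_mem_iff_exists_isLink e := by
    constructor
    · intro he
      obtain ⟨⟨x, y⟩, h⟩ := Sym2.mk_surjective e.ends
      exact ⟨x, y, he, h.symm⟩
    · rintro ⟨x, y, he, -⟩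
      exact he
  left_mem_of_isLink _ _ _ _ := Set.mem_univ _

open Classical in
/-- The multigraph `G/H`, where `H` is the subgraph of `G` induced by `U`: all edges of `H` are
deleted and the vertices in `U` are identified to one new vertex `none`; all other edges are kept,
possibly as parallel edges. -/
noncomputable def contract {V : Type*} (G : MixedGraph V) (U : Set V) :
    Graph (Option V) (MixedEdge V) :=
  (G.toGraph.deleteEdges {e | ∀ v ∈ e.ends, v ∈ U}).map fun v => if v ∈ U then none else some v

/-- Direction reduction of the first kind, to `G - e`: the edge `e` is a direction edge that belongs
to a direction-pure circuit of the rigidity matroid of `G`. -/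
def EdgeReduction {V : Type*} [Finite V] (G : MixedGraph V) (e : MixedEdge V) : Prop :=
  e.IsDir ∧ ∃ C, G.rigidityMatroid.IsCircuit C ∧ e ∈ C ∧ ∀ f ∈ C, f.IsDir

/-- Direction reduction of the second kind, to the proper induced subgraph `H = G[U]`: the multigraph
`G/H` is direction-pure and is the union of two edge-disjoint spanning trees. -/
def ContractionReduction {V : Type*} (G : MixedGraph V) (U : Set V) : Prop :=
  U.Nonempty ∧ U ≠ Set.univ ∧ (∀ e ∈ (G.contract U).edgeSet, e.IsDir) ∧
  ∃ T₁ T₂ : Set (MixedEdge V), (G.contract U).IsSpanningTree T₁ ∧ (G.contract U).IsSpanningTree T₂ ∧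
    Disjoint T₁ T₂ ∧ T₁ ∪ T₂ = (G.contract U).edgeSet

/-- `G` is direction irreducible: it has no direction reduction. -/
def DirectionIrreducible {V : Type*} [Finite V] (G : MixedGraph V) : Prop :=
  (¬ ∃ e, G.EdgeReduction e) ∧ ¬ ∃ U, G.ContractionReduction U

/-! ### Connectivity conditions -/

/-- `G` is 2-connected: it has at least three vertices, is connected, and remains connected when any
one vertex is deleted. -/
def TwoConnected {V : Type*} (G : MixedGraph V) : Prop :=
  3 ≤ Nat.card V ∧ (G.D ⊔ G.L).Connected ∧ ∀ v : V, ((G.D ⊔ G.L).induce {v}ᶜ).Connected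

/-- A subgraph of the mixed graph `G`. -/
structure Subgraph {V : Type*} (G : MixedGraph V) where
  verts : Set V
  D : SimpleGraph V
  L : SimpleGraph V
  D_le : D ≤ G.D
  L_le : L ≤ G.L
  D_verts : ∀ u v, D.Adj u v → u ∈ verts ∧ v ∈ verts
  L_verts : ∀ u v, L.Adj u v → u ∈ verts ∧ v ∈ verts

/-- `G = H₁ ∪ H₂`. -/
def IsUnion {V : Type*} (G : MixedGraph V) (H₁ H₂ : G.Subgraph) : Prop :=
  H₁.verts ∪ H₂.verts = Set.univ ∧ H₁.D ⊔ H₂.D = G.D ∧ H₁.L ⊔ H₂.L = G.L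

/-- `G` is direction-balanced: whenever `G = H₁ ∪ H₂`, where `H₁` and `H₂` share exactly two vertices
`u` and `v` and each has a vertex that the other one lacks, both `H₁` and `H₂` contain a direction
edge of `G` distinct from `uv`. -/
def DirectionBalanced {V : Type*} (G : MixedGraph V) : Prop :=
  ∀ (H₁ H₂ : G.Subgraph) (u v : V), u ≠ v → G.IsUnion H₁ H₂ → H₁.verts ∩ H₂.verts = {u, v} →
    (H₁.verts \ H₂.verts).Nonempty → (H₂.verts \ H₁.verts).Nonempty →
    (∃ e ∈ H₁.D.edgeSet, e ≠ s(u, v)) ∧ (∃ e ∈ H₂.D.edgeSet, e ≠ s(u, v))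

end MixedGraph

/-!
Identify the plane with `ℂ`. A motion `u` of a framework at a generic configuration `P` is a vector
field that satisfies the linear constraint of each edge, and the rigidity matroid is the matroid of
linear independence of these constraints.

The heart of the matter is that a circuit of the rigidity matroid has only similarities as motions;
by gluing along common edges, the same holds for a connected component of the matroid. If a
component contains edges of both kinds, then its only motions are translations. Hence an
`M`-connected graph with direction edges but without direction-pure circuits is redundantly rigid.

Conversely, redundant rigidity puts every edge into a circuit. Suppose that there are several
components. A component with vertex set `X` has rank at least `2 |X| - 2`, and still at least
`2 |X| - 3` if it has no direction edge, while 2-connectivity and direction balance give it at least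
two, respectively three, vertices of attachment. Summing over the components, where a vertex of
attachment is counted at least twice, the rank is at least `2 |V|`; but translations bound it by
`2 |V| - 2`.
-/
section LinearMatroid

variable {ι K W : Type*} [Finite ι] [Field K] [AddCommGroup W] [Module K W]

/-- The matroid of linear independence of a finite family of vectors. -/
noncomputable def linearMatroid (K : Type*) [Field K] [Module K W] (φ : ι → W) : Matroid ι :=
  (IndepMatroid.ofFinite (E := Set.univ) (Set.toFinite _) (LinearIndepOn K φ)
    (linearIndepOn_empty K φ) (fun _ _ hJ hIJ => hJ.mono hIJ)
    (by
      intro I J hI hJ hlt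
      by_contra! hcon
      have hspan : Submodule.span K (φ '' J) ≤ Submodule.span K (φ '' I) := by
        rw [Submodule.span_le]
        rintro _ ⟨e, he, rfl⟩
        by_contra hns
        have heI : e ∉ I := fun h => hns (Submodule.subset_span ⟨e, h, rfl⟩)
        exact hcon e he heI (hI.insert hns)
      have hfinrank (S : Set ι) (hS : LinearIndepOn K φ S) :
          Module.finrank K (Submodule.span K (φ '' S)) = S.ncard := by
        have := Fintype.ofFinite S
        rw [Set.image_eq_range, finrank_span_eq_card hS, ← Nat.card_eq_fintype_card,
          Nat.card_coe_set_eq]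
      have : FiniteDimensional K (Submodule.span K (φ '' I)) :=
        FiniteDimensional.span_of_finite K (Set.toFinite _)
      exact absurd (Submodule.finrank_mono hspan)
        (by rw [hfinrank J hJ, hfinrank I hI]; exact hlt.not_ge))
    (fun I _ => Set.subset_univ I)).matroid

@[simp] theorem linearMatroid_ground (φ : ι → W) : (linearMatroid K φ).E = Set.univ := rfl

@[simp] theorem linearMatroid_indep {φ : ι → W} {S : Set ι} :
    (linearMatroid K φ).Indep S ↔ LinearIndepOn K φ S := by
  simp [linearMatroid]

theorem linearMatroid_mem_closure {φ : ι → W} {S : Set ι} {e : ι} :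
    e ∈ (linearMatroid K φ).closure S ↔ φ e ∈ Submodule.span K (φ '' S) := by
  obtain ⟨I, hI⟩ := (linearMatroid K φ).exists_isBasis S
  have hIind := linearMatroid_indep.1 hI.indep
  have hspan : Submodule.span K (φ '' I) = Submodule.span K (φ '' S) := by
    refine le_antisymm (Submodule.span_mono (Set.image_mono hI.subset)) (Submodule.span_le.2 ?_)
    rintro _ ⟨f, hf, rfl⟩
    by_contra hns
    exact hns (Submodule.subset_span ⟨f, hI.mem_of_insert_indep hf
      (linearMatroid_indep.2 (hIind.insert hns)), rfl⟩)
  rw [← hI.closure_eq_closure, ← hspan, hIind.mem_span_iff, hI.indep.mem_closure_iff']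
  simp

theorem linearMatroid_mem_closure_dual {E : Type*} [AddCommGroup E] [Module K E]
    {φ : ι → Module.Dual K E} {S : Set ι} {e : ι} :
    e ∈ (linearMatroid K φ).closure S ↔ ∀ u, (∀ f ∈ S, φ f u = 0) → φ e u = 0 := by
  rw [linearMatroid_mem_closure]
  refine ⟨fun h u hu => ?_, fun h => ?_⟩
  · have : Submodule.span K (φ '' S) ≤ LinearMap.ker (Module.Dual.eval K E u) :=
      Submodule.span_le.2 (by rintro _ ⟨f, hf, rfl⟩; exact hu f hf)
    exact this h
  · rw [Set.image_eq_range]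
    refine mem_span_of_iInf_ker_le_ker fun u hu => h u fun f hf => ?_
    exact (Submodule.mem_iInf _).1 hu ⟨f, hf⟩

end LinearMatroid

open ComplexConjugate

namespace MixedEdge

variable {V : Type*}

/-- The complex number by which the edge vector `p u - p v` is multiplied in the rigidity matrix:
`1` for a length edge, and the rotation `-I` for a direction edge. -/
noncomputable def unit (e : MixedEdge V) : ℂ := Sum.elim (fun _ => -Complex.I) (fun _ => 1) e

theorem unit_inl (s : Sym2 V) : unit (Sum.inl s : MixedEdge V) = -Complex.I := rfl

theorem unit_inr (s : Sym2 V) : unit (Sum.inr s : MixedEdge V) = 1 := rfl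

theorem unit_eq_or (e : MixedEdge V) : e.unit = 1 ∨ e.unit = -Complex.I := by
  rcases e with _ | _
  · exact Or.inr rfl
  · exact Or.inl rfl

theorem unit_eq_of_isLeft_eq {e f : MixedEdge V} (h : Sum.isLeft e = Sum.isLeft f) :
    e.unit = f.unit := by
  rcases e with _ | _ <;> rcases f with _ | _ <;> first | rfl | exact absurd h (by simp)

theorem unit_ne_zero (e : MixedEdge V) : e.unit ≠ 0 := by
  rcases e with _ | _ <;> simp [unit]

theorem unit_mul_conj_unit (e : MixedEdge V) : e.unit * conj e.unit = 1 := by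
  rcases e with _ | _ <;> simp [unit]

theorem unit_eq_or_eq_mul_I (e f : MixedEdge V) (h : e.unit ≠ f.unit) :
    e.unit = f.unit * Complex.I ∨ e.unit = -(f.unit * Complex.I) := by
  rcases e with _ | _ <;> rcases f with _ | _ <;> simp_all [unit]

theorem unit_inl_ne_unit_inr (s t : Sym2 V) :
    unit (Sum.inl s : MixedEdge V) ≠ unit (Sum.inr t : MixedEdge V) := by
  simp [unit, Complex.ext_iff]

theorem unit_ne_of_isDir {e f : MixedEdge V} (he : e.IsDir) (hf : ¬ f.IsDir) :
    e.unit ≠ f.unit := by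
  obtain ⟨s, rfl⟩ := he
  rcases f with t | t
  · exact absurd ⟨t, rfl⟩ hf
  · exact unit_inl_ne_unit_inr s t

theorem eq_of_unit_eq_of_ends_eq {e f : MixedEdge V} (h₁ : e.unit = f.unit)
    (h₂ : e.ends = f.ends) : e = f := by
  rcases e with s | s <;> rcases f with t | t <;> simp_all [ends, unit, Complex.ext_iff]

theorem exists_unit_eq_ends_eq (e : MixedEdge V) (s : Sym2 V) :
    ∃ g : MixedEdge V, g.unit = e.unit ∧ g.ends = s := by
  rcases e with _ | _
  · exact ⟨Sum.inl s, rfl, rfl⟩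
  · exact ⟨Sum.inr s, rfl, rfl⟩

theorem exists_ends_eq (e : MixedEdge V) : ∃ a b, e.ends = s(a, b) := by
  induction h : e.ends with | _ a b
  exact ⟨a, b, rfl⟩

theorem exists_ends_eq_of_mem {e : MixedEdge V} {v : V} (hv : v ∈ e.ends)
    (he : ¬ e.ends.IsDiag) : ∃ a, e.ends = s(v, a) ∧ v ≠ a := by
  obtain ⟨a, ha⟩ := hv
  exact ⟨a, ha, by rwa [ha, Sym2.mk_isDiag_iff] at he⟩

/-- The set of end vertices of a set of edges. -/
def verts (S : Set (MixedEdge V)) : Set V := {x | ∃ e ∈ S, x ∈ e.ends}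

theorem mem_verts_left {S : Set (MixedEdge V)} {e : MixedEdge V} (he : e ∈ S) {a b : V}
    (h : e.ends = s(a, b)) : a ∈ verts S := ⟨e, he, h ▸ Sym2.mem_mk_left a b⟩

theorem mem_verts_right {S : Set (MixedEdge V)} {e : MixedEdge V} (he : e ∈ S) {a b : V}
    (h : e.ends = s(a, b)) : b ∈ verts S := ⟨e, he, h ▸ Sym2.mem_mk_right a b⟩

theorem verts_mono {S T : Set (MixedEdge V)} (h : S ⊆ T) : verts S ⊆ verts T :=
  fun _ ⟨e, he, hx⟩ => ⟨e, h he, hx⟩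

theorem sum_card_filter_mem_ends [DecidableEq V] (C : Finset (MixedEdge V))
    (hC : ∀ e ∈ C, ¬ e.ends.IsDiag) (X : Finset V) (hX : verts (C : Set (MixedEdge V)) ⊆ X) :
    ∑ v ∈ X, (C.filter fun e => v ∈ e.ends).card = 2 * C.card := by
  have hcount := Finset.sum_card_bipartiteAbove_eq_sum_card_bipartiteBelow
    (s := X) (t := C) (fun v e => v ∈ e.ends)
  unfold Finset.bipartiteAbove Finset.bipartiteBelow at hcount
  rw [hcount, Finset.sum_congr rfl (g := fun _ => 2), Finset.sum_const, smul_eq_mul, mul_comm]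
  intro e he
  rw [← Sym2.card_toFinset_of_not_isDiag e.ends (hC e he)]
  congr 1
  ext x
  rw [Finset.mem_filter, Sym2.mem_toFinset, and_iff_right_iff_imp]
  exact fun hx => hX ⟨e, he, hx⟩

/-- The linear constraint that an edge imposes on an infinitesimal motion `u` at `P`, where the
plane is identified with `ℂ`. -/
noncomputable def constraint (P : V → ℂ) (e : MixedEdge V) : Module.Dual ℝ (V → ℂ) where
  toFun u := e.ends.lift ⟨fun a b => (e.unit * (P a - P b) * conj (u a - u b)).re,
    fun a b => by
      dsimp only; rw [← neg_sub (P b), ← neg_sub (u b), map_neg]; ring_nf⟩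
  map_add' u v := by
    induction e.ends with | _ a b
    simp; ring
  map_smul' r u := by
    induction e.ends with | _ a b
    simp; ring

theorem constraint_apply {P u : V → ℂ} {e : MixedEdge V} {a b : V} (h : e.ends = s(a, b)) :
    constraint P e u = (e.unit * (P a - P b) * conj (u a - u b)).re := by
  simp only [constraint, LinearMap.coe_mk, AddHom.coe_mk, h, Sym2.lift_mk]

theorem constraint_congr {P Q u w : V → ℂ} {e : MixedEdge V}
    (h : ∀ x ∈ e.ends, ∀ y ∈ e.ends, P x - P y = Q x - Q y ∧ u x - u y = w x - w y) :
    constraint P e u = constraint Q e w := by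
  obtain ⟨a, b, hab⟩ := exists_ends_eq e
  have := h a (hab ▸ Sym2.mem_mk_left a b) b (hab ▸ Sym2.mem_mk_right a b)
  rw [constraint_apply hab, constraint_apply hab, this.1, this.2]

theorem constraint_eq_zero_of_const {P u : V → ℂ} {e : MixedEdge V}
    (h : ∀ x ∈ e.ends, ∀ y ∈ e.ends, u x = u y) : constraint P e u = 0 := by
  rw [constraint_congr (w := 0) fun x hx y hy => ⟨rfl, by simp [h x hx y hy]⟩, map_zero]

theorem continuous_constraint_apply (e : MixedEdge V) (u : V → ℂ) :
    Continuous fun P : V → ℂ => constraint P e u := by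
  obtain ⟨a, b, hab⟩ := exists_ends_eq e
  simp_rw [constraint_apply hab]
  fun_prop

/-- `u` is an infinitesimal motion at `P` of the edges in `S`. -/
def IsMotion (P : V → ℂ) (S : Set (MixedEdge V)) (u : V → ℂ) : Prop :=
  ∀ e ∈ S, constraint P e u = 0

theorem IsMotion.mono {P u : V → ℂ} {S T : Set (MixedEdge V)} (h : IsMotion P T u) (hST : S ⊆ T) :
    IsMotion P S u := fun e he => h e (hST he)

theorem isMotion_insert {P u : V → ℂ} {S : Set (MixedEdge V)} {e : MixedEdge V} :
    IsMotion P (insert e S) u ↔ constraint P e u = 0 ∧ IsMotion P S u := Set.forall_mem_insert ..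

theorem IsMotion.insert {P u : V → ℂ} {S : Set (MixedEdge V)} {e : MixedEdge V}
    (h : IsMotion P S u) (he : constraint P e u = 0) : IsMotion P (insert e S) u :=
  isMotion_insert.2 ⟨he, h⟩

/-- The matroid of linear independence of the constraints at `P` of all potential edges. -/
noncomputable abbrev constraintMatroid [Finite V] (P : V → ℂ) : Matroid (MixedEdge V) :=
  linearMatroid ℝ (constraint P)

theorem mem_closure_iff [Finite V] {P : V → ℂ} {S : Set (MixedEdge V)} {e : MixedEdge V} :
    e ∈ (constraintMatroid P).closure S ↔ ∀ u, IsMotion P S u → constraint P e u = 0 :=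
  linearMatroid_mem_closure_dual

theorem linearIndepOn_insert_of_isMotion {P u : V → ℂ} {S : Set (MixedEdge V)} {e : MixedEdge V}
    (hS : LinearIndepOn ℝ (constraint P) S) (hu : IsMotion P S u) (he : constraint P e u ≠ 0) :
    LinearIndepOn ℝ (constraint P) (insert e S) := by
  refine hS.insert fun hmem => he ?_
  have : Submodule.span ℝ (constraint P '' S) ≤ LinearMap.ker (Module.Dual.eval ℝ (V → ℂ) u) :=
    Submodule.span_le.2 (by rintro _ ⟨f, hf, rfl⟩; exact hu f hf)
  exact this hmem

section Counting

variable {P : V → ℂ}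

/-- A vector on `Y`, extended by zero to `V`. -/
noncomputable abbrev extendZero (Y : Set V) : (Y → ℂ) →ₗ[ℝ] (V → ℂ) :=
  (Function.ExtendByZero.linearMap ℂ ((↑) : Y → V)).restrictScalars ℝ

theorem extendZero_of_mem {Y : Set V} (w : Y → ℂ) {v : V} (h : v ∈ Y) :
    extendZero Y w v = w ⟨v, h⟩ := Subtype.val_injective.extend_apply w 0 ⟨v, h⟩

theorem extendZero_of_notMem {Y : Set V} (w : Y → ℂ) {v : V} (h : v ∉ Y) :
    extendZero Y w v = 0 :=
  Function.extend_apply' _ _ _ fun ⟨y, hy⟩ => h (hy ▸ y.2)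

theorem ncard_add_two_le_of_linearIndepOn [Finite V] {S : Set (MixedEdge V)}
    (hS : LinearIndepOn ℝ (constraint P) S) {X : Set V} (hX : X.Nonempty) (hSX : verts S ⊆ X) :
    S.ncard + 2 ≤ 2 * X.ncard := by
  obtain ⟨x₀, hx₀⟩ := hX
  have := Fintype.ofFinite V
  have := Fintype.ofFinite S
  let Y := X \ {x₀}
  have := Fintype.ofFinite Y
  let ρ : (V → ℂ) →ₗ[ℝ] (Y → ℂ) :=
    LinearMap.pi fun y => LinearMap.proj (R := ℝ) (φ := fun _ => ℂ) (y : V) - LinearMap.proj x₀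
  have hρ (u : V → ℂ) (x : V) (hx : x ∈ X) : extendZero Y (ρ u) x = u x - u x₀ := by
    by_cases hxx : x = x₀
    · rw [extendZero_of_notMem _ fun h => h.2 hxx, hxx, sub_self]
    · exact extendZero_of_mem _ (show x ∈ Y from ⟨hx, hxx⟩)
  have hfactor (e : S) : ρ.dualMap ((extendZero Y).dualMap (constraint P e)) = constraint P e := by
    refine LinearMap.ext fun u => constraint_congr fun x hx y hy => ⟨rfl, ?_⟩
    rw [hρ u x (hSX ⟨e, e.2, hx⟩), hρ u y (hSX ⟨e, e.2, hy⟩), sub_sub_sub_cancel_right]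
  have hind : LinearIndependent ℝ fun e : S => (extendZero Y).dualMap (constraint P e) :=
    LinearIndependent.of_comp ρ.dualMap (by
      rw [show ρ.dualMap ∘ _ = fun e : S => constraint P e from funext hfactor]; exact hS)
  have hle := hind.fintype_card_le_finrank
  rw [Subspace.dual_finrank_eq, Module.finrank_pi_fintype] at hle
  simp only [Complex.finrank_real_complex, Finset.sum_const, Finset.card_univ, smul_eq_mul,
    ← Nat.card_eq_fintype_card, Nat.card_coe_set_eq] at hle
  have : Y.ncard + 1 = X.ncard := Set.ncard_sdiff_singleton_add_one hx₀ (Set.toFinite X)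
  omega

theorem two_mul_ncard_le_of_forall_isMotion [Finite V] {S : Set (MixedEdge V)} {Y : Set V}
    (h : ∀ u, IsMotion P S u → ∀ x ∈ Y, ∀ y ∈ Y, u x = u y) :
    2 * Y.ncard ≤ S.ncard + 2 := by
  have := Fintype.ofFinite V
  have := Fintype.ofFinite S
  have := Fintype.ofFinite Y
  rcases Y.eq_empty_or_nonempty with rfl | ⟨y₀, hy₀⟩
  · simp
  let Ψ : (Y → ℂ) →ₗ[ℝ] (S → ℝ) × ℂ :=
    (LinearMap.pi fun e : S => constraint P (e : MixedEdge V) ∘ₗ extendZero Y).prod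
      (LinearMap.proj (R := ℝ) (⟨y₀, hy₀⟩ : Y))
  have hinj : Function.Injective Ψ := by
    rw [injective_iff_map_eq_zero]
    intro w hw
    have hmot : IsMotion P S (extendZero Y w) := fun e he =>
      congrFun (congrArg Prod.fst hw) ⟨e, he⟩
    funext ⟨y, hy⟩
    have := h _ hmot y hy y₀ hy₀
    rw [extendZero_of_mem _ hy, extendZero_of_mem _ hy₀] at this
    exact this.trans (congrArg Prod.snd hw)
  have hle := LinearMap.finrank_le_finrank_of_injective hinj
  rw [Module.finrank_prod, Module.finrank_pi_fintype, Module.finrank_pi_fintype] at hle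
  simp only [Complex.finrank_real_complex, Finset.sum_const, Finset.card_univ, smul_eq_mul,
    Module.finrank_self, mul_one, ← Nat.card_eq_fintype_card, Nat.card_coe_set_eq] at hle
  omega

end Counting

end MixedEdge

/-- The identification of the plane with the complex numbers. -/
noncomputable def toComplex : Plane ≃ₗᵢ[ℝ] ℂ := Complex.orthonormalBasisOneI.repr.symm

theorem toComplex_eq (x : Plane) : toComplex x = ⟨x 0, x 1⟩ := by
  apply toComplex.symm.injective
  rw [toComplex.symm_apply_apply]
  ext i
  fin_cases i <;> simp [toComplex]

theorem exists_aeval_eq_row {V : Type*} (e : MixedEdge V) (x : V × Fin 2) :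
    ∃ Q : MvPolynomial (V × Fin 2) ℚ, ∀ p : V → Plane,
      MvPolynomial.aeval (fun y : V × Fin 2 => p y.1 y.2) Q = MixedEdge.row p e x := by
  classical
  obtain ⟨v, i⟩ := x
  open MvPolynomial in
  rcases e with s | s <;> induction s with | _ a b
  · refine ⟨(if v = a then ![X (a, 1) - X (b, 1), -(X (a, 0) - X (b, 0))] i else 0) +
      (if v = b then ![X (b, 1) - X (a, 1), -(X (b, 0) - X (a, 0))] i else 0), fun p => ?_⟩
    simp only [MixedEdge.row, Sym2.lift_mk]
    fin_cases i <;> split_ifs <;> simp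
  · refine ⟨(if v = a then X (a, i) - X (b, i) else 0) +
      (if v = b then X (b, i) - X (a, i) else 0), fun p => ?_⟩
    simp only [MixedEdge.row, Sym2.lift_mk]
    split_ifs <;> simp

theorem linearIndependent_row_iff_det_mul_transpose_ne_zero {ι κ : Type*} [Fintype ι]
    [DecidableEq ι] [Fintype κ] (A : Matrix ι κ ℝ) :
    LinearIndependent ℝ A.row ↔ (A * A.transpose).det ≠ 0 := by
  let toLp := (WithLp.linearEquiv 2 ℝ (κ → ℝ)).symm
  have hgram : Matrix.gram ℝ (toLp ∘ A.row) = A * A.transpose := by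
    ext i j
    simp [toLp, Matrix.gram_apply, PiLp.inner_apply, Matrix.mul_apply, mul_comm]
  rw [← hgram, Matrix.det_gram_ne_zero_iff_linearIndependent]
  exact (toLp.toLinearMap.linearIndependent_iff_of_injOn toLp.injective.injOn).symm

namespace MixedEdge

variable {V : Type*}

/-- The coordinates of the points of a configuration, in the order of the columns of the rigidity
matrix. -/
noncomputable def coords (V : Type*) : (V → ℂ) ≃ₗ[ℝ] (V × Fin 2 → ℝ) :=
  (LinearEquiv.piCongrRight fun _ => Complex.basisOneI.equivFun).trans
    (LinearEquiv.curry ℝ ℝ V (Fin 2)).symm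

theorem row_dotProduct_coords [Fintype V] (p : V → Plane) (e : MixedEdge V) (u : V → ℂ) :
    row p e ⬝ᵥ coords V u = constraint (toComplex ∘ p) e u := by
  classical
  have hsum (r : V × Fin 2 → ℝ) :
      r ⬝ᵥ coords V u = ∑ v, (r (v, 0) * (u v).re + r (v, 1) * (u v).im) := by
    simp [dotProduct, coords, Fintype.sum_prod_type]
  rw [hsum]
  rcases e with s | s <;> induction s with | _ a b
  · rw [constraint_apply (a := a) (b := b) rfl]
    simp [row, toComplex_eq, add_mul, ite_mul, Finset.sum_add_distrib, unit_inl]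
    ring
  · rw [constraint_apply (a := a) (b := b) rfl]
    simp [row, toComplex_eq, add_mul, ite_mul, Finset.sum_add_distrib, unit_inr]
    ring

theorem linearIndepOn_row_iff [Finite V] {p : V → Plane} {S : Set (MixedEdge V)} :
    LinearIndepOn ℝ (row p) S ↔ LinearIndepOn ℝ (constraint (toComplex ∘ p)) S := by
  classical
  have := Fintype.ofFinite V
  let functional : (V × Fin 2 → ℝ) ≃ₗ[ℝ] Module.Dual ℝ (V → ℂ) :=
    (dotProductEquiv ℝ (V × Fin 2)).trans (coords V).dualMap
  have hrow : constraint (toComplex ∘ p) = functional ∘ row p :=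
    funext fun e => LinearMap.ext fun u => (row_dotProduct_coords p e u).symm
  rw [hrow]
  exact (functional.toLinearMap.linearIndepOn_iff_of_injOn functional.injective.injOn).symm

end MixedEdge

namespace IsGeneric

variable {V : Type*} {p : V → Plane}

theorem aeval_ne_zero (hp : IsGeneric p) {Q : MvPolynomial (V × Fin 2) ℚ}
    (q : V → Plane) (h : MvPolynomial.aeval (fun y : V × Fin 2 => q y.1 y.2) Q ≠ 0) :
    MvPolynomial.aeval (fun y : V × Fin 2 => p y.1 y.2) Q ≠ 0 :=
  fun h0 => h (by rw [hp.eq_zero_of_aeval_eq_zero Q h0, map_zero])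

theorem linearIndepOn_row [Finite V] (hp : IsGeneric p) {q : V → Plane} {S : Set (MixedEdge V)}
    (h : LinearIndepOn ℝ (MixedEdge.row q) S) : LinearIndepOn ℝ (MixedEdge.row p) S := by
  classical
  have := Fintype.ofFinite V
  have := Fintype.ofFinite S
  choose Q hQ using @exists_aeval_eq_row V
  let symbolic : Matrix S (V × Fin 2) (MvPolynomial (V × Fin 2) ℚ) := Matrix.of fun e x => Q e x
  have hmap (r : V → Plane) : symbolic.map (MvPolynomial.aeval fun y => r y.1 y.2) =
      Matrix.of fun (e : S) x => MixedEdge.row r e x := by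
    ext e x
    exact hQ e x r
  have hdet (r : V → Plane) : LinearIndepOn ℝ (MixedEdge.row r) S ↔
      MvPolynomial.aeval (fun y => r y.1 y.2) (symbolic * symbolic.transpose).det ≠ 0 := by
    rw [AlgHom.map_det, AlgHom.mapMatrix_apply, Matrix.map_mul, Matrix.transpose_map, hmap,
      ← linearIndependent_row_iff_det_mul_transpose_ne_zero]
    rfl
  rw [hdet] at h ⊢
  exact hp.aeval_ne_zero q h

theorem linearIndepOn_constraint [Finite V] (hp : IsGeneric p) {Q : V → ℂ} {S : Set (MixedEdge V)}
    (h : LinearIndepOn ℝ (MixedEdge.constraint Q) S) :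
    LinearIndepOn ℝ (MixedEdge.constraint (toComplex ∘ p)) S := by
  have hQ : Q = toComplex ∘ toComplex.symm ∘ Q :=
    funext fun v => (toComplex.apply_symm_apply (Q v)).symm
  rw [hQ, ← MixedEdge.linearIndepOn_row_iff] at h
  exact MixedEdge.linearIndepOn_row_iff.1 (hp.linearIndepOn_row h)

theorem re_mul_conj_ne_zero (hp : IsGeneric p) {v a b : V} (ha : v ≠ a) (hb : v ≠ b) :
    ((toComplex (p v) - toComplex (p a)) * conj (toComplex (p v) - toComplex (p b))).re ≠ 0 := by
  classical
  open MvPolynomial in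
  have := hp.aeval_ne_zero (Q := (X (v, 0) - X (a, 0)) * (X (v, 0) - X (b, 0)) +
    (X (v, 1) - X (a, 1)) * (X (v, 1) - X (b, 1)))
    (fun x => WithLp.toLp 2 fun i => if x = v ∧ i = 0 then 1 else 0) (by simp [ha.symm, hb.symm])
  convert this using 1
  simp [toComplex_eq]
  ring

theorem im_mul_conj_ne_zero (hp : IsGeneric p) {v a b : V} (ha : v ≠ a) (hb : v ≠ b) (hab : a ≠ b) :
    ((toComplex (p v) - toComplex (p a)) * conj (toComplex (p v) - toComplex (p b))).im ≠ 0 := by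
  classical
  open MvPolynomial in
  have := hp.aeval_ne_zero (Q := (X (v, 1) - X (a, 1)) * (X (v, 0) - X (b, 0)) -
    (X (v, 0) - X (a, 0)) * (X (v, 1) - X (b, 1)))
    (fun x => WithLp.toLp 2 fun i => if (x = v ∧ i = 1) ∨ (x = b ∧ i = 0) then 1 else 0)
      (by simp [ha.symm, hb, hb.symm, hab])
  convert this using 1
  simp [toComplex_eq]
  ring

end IsGeneric

/-- The properties of a generic configuration of points that the rigidity matroid depends on: every
set of edges that is independent somewhere is independent at `P`, and no two edges at a vertex are
parallel or orthogonal to each other. -/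
structure GenericConfig {V : Type*} (P : V → ℂ) : Prop where
  linearIndepOn : ∀ (Q : V → ℂ) (S : Set (MixedEdge V)),
    LinearIndepOn ℝ (MixedEdge.constraint Q) S → LinearIndepOn ℝ (MixedEdge.constraint P) S
  re_ne_zero : ∀ {v a b : V}, v ≠ a → v ≠ b → ((P v - P a) * conj (P v - P b)).re ≠ 0
  im_ne_zero : ∀ {v a b : V}, v ≠ a → v ≠ b → a ≠ b → ((P v - P a) * conj (P v - P b)).im ≠ 0

theorem IsGeneric.genericConfig {V : Type*} [Finite V] {p : V → Plane} (hp : IsGeneric p) :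
    GenericConfig (toComplex ∘ p) where
  linearIndepOn _ _ h := hp.linearIndepOn_constraint h
  re_ne_zero := hp.re_mul_conj_ne_zero
  im_ne_zero := hp.im_mul_conj_ne_zero

namespace GenericConfig

open MixedEdge

variable {V : Type*} {P : V → ℂ}

theorem sub_ne_zero (hP : GenericConfig P) {a b : V} (h : a ≠ b) : P a - P b ≠ 0 :=
  fun h0 => hP.re_ne_zero h h (by simp [h0])

theorem im_unit_mul_sub_mul_conj_ne_zero (hP : GenericConfig P) {e f : MixedEdge V} {v a b : V}
    (he : e.ends = s(v, a)) (hf : f.ends = s(v, b)) (ha : v ≠ a) (hb : v ≠ b) (hef : e ≠ f) :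
    (e.unit * (P v - P a) * conj (f.unit * (P v - P b))).im ≠ 0 := by
  rw [map_mul, mul_mul_mul_comm]
  by_cases h : e.unit = f.unit
  · have hab : a ≠ b := fun hab => hef (eq_of_unit_eq_of_ends_eq h (by rw [he, hf, hab]))
    rw [h, unit_mul_conj_unit, one_mul]
    exact hP.im_ne_zero ha hb hab
  · have hre := hP.re_ne_zero ha hb
    rcases unit_eq_or_eq_mul_I e f h with h | h
    · rw [h, mul_right_comm f.unit, unit_mul_conj_unit, one_mul, Complex.I_mul_im]
      exact hre
    · rw [h, neg_mul, mul_right_comm f.unit, unit_mul_conj_unit, one_mul, neg_mul, Complex.neg_im,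
        Complex.I_mul_im]
      exact neg_ne_zero.2 hre

end GenericConfig

section ComplexPlane

variable {f g : ℂ}

theorem exists_re_mul_conj_eq (h : (f * conj g).im ≠ 0) (r s : ℝ) :
    ∃ y : ℂ, (f * conj y).re = r ∧ (g * conj y).re = s := by
  obtain ⟨d, hd⟩ : ∃ d, (f.im * g.re - f.re * g.im) * d = 1 := by
    rw [Complex.mul_im, Complex.conj_re, Complex.conj_im, mul_neg, neg_add_eq_sub] at h
    exact ⟨_, mul_inv_cancel₀ h⟩
  refine ⟨⟨(s * f.im - r * g.im) * d, (r * g.re - s * f.re) * d⟩, ?_, ?_⟩ <;>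
    simp only [Complex.mul_re, Complex.conj_re, Complex.conj_im]
  · linear_combination r * hd
  · linear_combination s * hd

theorem eq_zero_of_re_mul_conj_eq_zero (h : (f * conj g).im ≠ 0) {y : ℂ}
    (hf : (f * conj y).re = 0) (hg : (g * conj y).re = 0) : y = 0 := by
  simp only [Complex.mul_re, Complex.mul_im, Complex.conj_re, Complex.conj_im] at h hf hg
  refine Complex.ext ((mul_eq_zero.1 ?_).resolve_left h) ((mul_eq_zero.1 ?_).resolve_left h)
  · linear_combination f.im * hg - g.im * hf
  · linear_combination g.re * hf - f.re * hg

end ComplexPlane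

namespace MixedEdge

variable {V : Type*} {P : V → ℂ}

theorem constraint_single [DecidableEq V] {e : MixedEdge V} {v a : V} (h : e.ends = s(v, a))
    (hva : v ≠ a) (y : ℂ) :
    constraint P e (Pi.single v y) = (e.unit * (P v - P a) * conj y).re := by
  rw [constraint_apply h, Pi.single_eq_same, Pi.single_eq_of_ne hva.symm, sub_zero]

theorem constraint_single_of_notMem [DecidableEq V] {e : MixedEdge V} {v : V} (h : v ∉ e.ends)
    (y : ℂ) : constraint P e (Pi.single v y) = 0 := by
  have hne {x : V} (hx : x ∈ e.ends) : x ≠ v := ne_of_mem_of_not_mem hx h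
  exact constraint_eq_zero_of_const fun x hx z hz => by
    rw [Pi.single_eq_of_ne (hne hx), Pi.single_eq_of_ne (hne hz)]

theorem constraint_update_left [DecidableEq V] {e : MixedEdge V} {v : V} (h : v ∉ e.ends) (w : ℂ) :
    constraint (Function.update P v w) e = constraint P e :=
  LinearMap.ext fun _ => constraint_congr fun x hx y hy => by
    rw [Function.update_of_ne (ne_of_mem_of_not_mem hx h),
      Function.update_of_ne (ne_of_mem_of_not_mem hy h)]
    exact ⟨rfl, rfl⟩

theorem constraint_update_right [DecidableEq V] {e : MixedEdge V} {v : V} (h : v ∉ e.ends)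
    (u : V → ℂ) (w : ℂ) : constraint P e (Function.update u v w) = constraint P e u :=
  constraint_congr fun x hx y hy => by
    rw [Function.update_of_ne (ne_of_mem_of_not_mem hx h),
      Function.update_of_ne (ne_of_mem_of_not_mem hy h)]
    exact ⟨rfl, rfl⟩

section TwoEdges

variable {S : Set (MixedEdge V)} {v a b : V} {e f : MixedEdge V}

theorem linearIndepOn_insert_insert (hS : LinearIndepOn ℝ (constraint P) S)
    (hv : ∀ g ∈ S, v ∉ g.ends) (he : e.ends = s(v, a)) (hf : f.ends = s(v, b)) (ha : v ≠ a)
    (hb : v ≠ b) (h : (e.unit * (P v - P a) * conj (f.unit * (P v - P b))).im ≠ 0) :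
    LinearIndepOn ℝ (constraint P) (insert f (insert e S)) := by
  classical
  have hmot (y : ℂ) : IsMotion P S (Pi.single v y) :=
    fun g hg => constraint_single_of_notMem (hv g hg) y
  obtain ⟨y, hy, -⟩ := exists_re_mul_conj_eq h 1 0
  obtain ⟨z, hez, hfz⟩ := exists_re_mul_conj_eq h 0 1
  refine linearIndepOn_insert_of_isMotion (linearIndepOn_insert_of_isMotion hS (hmot y) ?_)
    ((hmot z).insert ?_) ?_
  · rw [constraint_single he ha, hy]; exact one_ne_zero
  · rw [constraint_single he ha, hez]
  · rw [constraint_single hf hb, hfz]; exact one_ne_zero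

theorem exists_isMotion_insert_insert [DecidableEq V] {u : V → ℂ} (hu : IsMotion P S u)
    (hv : ∀ g ∈ S, v ∉ g.ends) (he : e.ends = s(v, a)) (hf : f.ends = s(v, b)) (ha : v ≠ a)
    (hb : v ≠ b) (h : (e.unit * (P v - P a) * conj (f.unit * (P v - P b))).im ≠ 0) :
    ∃ x, IsMotion P (insert f (insert e S)) (Function.update u v x) := by
  obtain ⟨x, hex, hfx⟩ := exists_re_mul_conj_eq h
    (e.unit * (P v - P a) * conj (u a)).re (f.unit * (P v - P b) * conj (u b)).re
  refine ⟨x, IsMotion.insert (IsMotion.insert (fun g hg => ?_) ?_) ?_⟩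
  · rw [constraint_update_right (hv g hg), hu g hg]
  · rw [constraint_apply he, Function.update_self, Function.update_of_ne ha.symm, map_sub,
      mul_sub, Complex.sub_re, hex, sub_self]
  · rw [constraint_apply hf, Function.update_self, Function.update_of_ne hb.symm, map_sub,
      mul_sub, Complex.sub_re, hfx, sub_self]

end TwoEdges

end MixedEdge

namespace GenericConfig

open MixedEdge

variable {V : Type*} {P : V → ℂ} {C : Set (MixedEdge V)}

theorem exists_re_unit_mul_sub_mul_conj_eq (hP : GenericConfig P) {e f : MixedEdge V} {v a b : V}
    (he : e.ends = s(v, a)) (hf : f.ends = s(v, b)) (ha : v ≠ a) (hb : v ≠ b) (hef : e ≠ f) :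
    ∃ y : ℂ, (e.unit * (P v - P a) * conj y).re = 1 ∧ (f.unit * (P v - P b) * conj y).re = 0 :=
  exists_re_mul_conj_eq (hP.im_unit_mul_sub_mul_conj_ne_zero he hf ha hb hef) 1 0

variable [Finite V]

theorem three_le_ncard_of_isCircuit (hP : GenericConfig P)
    (hC : (constraintMatroid P).IsCircuit C) (hdiag : ∀ e ∈ C, ¬ e.ends.IsDiag) {v : V}
    (hv : v ∈ verts C) : 3 ≤ {e ∈ C | v ∈ e.ends}.ncard := by
  classical
  by_contra! hlt
  obtain ⟨e, heC, hve⟩ := hv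
  obtain ⟨a, hea, hva⟩ := exists_ends_eq_of_mem hve (hdiag e heC)
  have : Nonempty (MixedEdge V) := ⟨e⟩
  obtain ⟨f, hf⟩ : ∃ f, {e ∈ C | v ∈ e.ends} \ {e} ⊆ {f} := by
    rw [← Set.ncard_le_one_iff_subset_singleton,
      Set.ncard_sdiff_singleton_of_mem (show e ∈ {e ∈ C | v ∈ e.ends} from ⟨heC, hve⟩)]
    omega
  obtain ⟨y, hey, hfy⟩ : ∃ y, constraint P e (Pi.single v y) ≠ 0 ∧
      (f ∈ C → f ≠ e → constraint P f (Pi.single v y) = 0) := by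
    simp_rw [constraint_single hea hva]
    by_cases hvf : f ∈ C ∧ v ∈ f.ends ∧ f ≠ e
    · obtain ⟨hfC, hvf, hfe⟩ := hvf
      obtain ⟨b, hfb, hvb⟩ := exists_ends_eq_of_mem hvf (hdiag f hfC)
      obtain ⟨y, hey, hfy⟩ :=
        hP.exists_re_unit_mul_sub_mul_conj_eq hea hfb hva hvb hfe.symm
      exact ⟨y, by rw [hey]; exact one_ne_zero, fun _ _ => (constraint_single hfb hvb y).trans hfy⟩
    · refine ⟨e.unit * (P v - P a), ?_, fun hfC hfe =>
        constraint_single_of_notMem (fun h => hvf ⟨hfC, h, hfe⟩) _⟩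
      rw [Complex.mul_conj, Complex.ofReal_re]
      exact Complex.normSq_eq_zero.not.2 (mul_ne_zero (unit_ne_zero e) (hP.sub_ne_zero hva))
  refine hey (mem_closure_iff.1 (hC.mem_closure_sdiff_singleton_of_mem heC) _ fun g hg => ?_)
  by_cases hvg : v ∈ g.ends
  · obtain rfl : g = f := hf ⟨⟨hg.1, hvg⟩, hg.2⟩
    exact hfy hg.1 hg.2
  · exact constraint_single_of_notMem hvg y

theorem exists_ncard_eq_three_of_isCircuit (hP : GenericConfig P)
    (hC : (constraintMatroid P).IsCircuit C) (hdiag : ∀ e ∈ C, ¬ e.ends.IsDiag) :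
    ∃ v, {e ∈ C | v ∈ e.ends}.ncard = 3 := by
  classical
  obtain ⟨e, he⟩ := hC.nonempty
  obtain ⟨a, b, hab⟩ := exists_ends_eq e
  have hle : (C \ {e}).ncard + 2 ≤ 2 * (verts C).ncard :=
    ncard_add_two_le_of_linearIndepOn (linearMatroid_indep.1 (hC.sdiff_singleton_indep he))
      ⟨a, mem_verts_left he hab⟩ (verts_mono Set.sdiff_subset)
  have hdel : (C \ {e}).ncard + 1 = C.ncard := Set.ncard_sdiff_singleton_add_one he
  have hsum := sum_card_filter_mem_ends C.toFinite.toFinset (by simpa using hdiag)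
    (verts C).toFinite.toFinset (by simp)
  rw [← Set.ncard_eq_toFinset_card C] at hsum
  by_contra! hne
  have hfour (v : V) (hv : v ∈ (verts C).toFinite.toFinset) :
      4 ≤ (C.toFinite.toFinset.filter fun e => v ∈ e.ends).card := by
    have hcard : (C.toFinite.toFinset.filter fun e => v ∈ e.ends).card =
        {e ∈ C | v ∈ e.ends}.ncard := by
      rw [← Set.ncard_coe_finset]
      congr 1
      ext
      simp
    have := hP.three_le_ncard_of_isCircuit hC hdiag ((Set.Finite.mem_toFinset _).1 hv)
    have := hne v
    omega
  have := Finset.card_nsmul_le_sum _ _ 4 hfour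
  rw [smul_eq_mul, ← Set.ncard_eq_toFinset_card (verts C)] at this
  omega

end GenericConfig

/-- The edges of `C` at `v` are the three distinct edges `e i`, and `a i` is the end of `e i` other
than `v`. -/
structure IsTrivalentAt {V : Type*} (C : Set (MixedEdge V)) (v : V) (e : Fin 3 → MixedEdge V)
    (a : Fin 3 → V) : Prop where
  injective : Function.Injective e
  range_eq : Set.range e = {f ∈ C | v ∈ f.ends}
  ends_eq : ∀ i, (e i).ends = s(v, a i)
  ne : ∀ i, v ≠ a i

theorem eq_or_eq_or_eq_of_ne {i j k : Fin 3} (hij : i ≠ j) (hik : i ≠ k) (hjk : j ≠ k)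
    (l : Fin 3) : l = i ∨ l = j ∨ l = k := by decide +revert

namespace IsTrivalentAt

open MixedEdge

variable {V : Type*} {P : V → ℂ} {C : Set (MixedEdge V)} {v : V} {e : Fin 3 → MixedEdge V}
  {a : Fin 3 → V}

theorem exists_of_ncard_eq_three (hdiag : ∀ e ∈ C, ¬ e.ends.IsDiag)
    (hv : {f ∈ C | v ∈ f.ends}.ncard = 3) : ∃ e a, IsTrivalentAt C v e a := by
  have : Finite {f ∈ C | v ∈ f.ends} := Set.finite_of_ncard_ne_zero (by omega)
  let φ := (Finite.equivFinOfCardEq (α := {f ∈ C | v ∈ f.ends}) hv).symm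
  choose a ha hne using fun i => exists_ends_eq_of_mem (φ i).2.2 (hdiag _ (φ i).2.1)
  refine ⟨fun i => φ i, a, Subtype.val_injective.comp φ.injective, ?_, ha, hne⟩
  rw [show Set.range (fun i => (φ i : MixedEdge V)) = Subtype.val '' Set.range φ from
    Set.range_comp _ _, φ.range_eq_univ, Set.image_univ, Subtype.range_coe]

theorem mem (T : IsTrivalentAt C v e a) (i : Fin 3) : e i ∈ C :=
  (T.range_eq ▸ Set.mem_range_self i : e i ∈ {f ∈ C | v ∈ f.ends}).1

theorem ne_of_unit_eq (T : IsTrivalentAt C v e a) {i j : Fin 3} (hij : i ≠ j)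
    (h : (e i).unit = (e j).unit) : a i ≠ a j := fun ha =>
  hij (T.injective (eq_of_unit_eq_of_ends_eq h (by rw [T.ends_eq, T.ends_eq, ha])))

theorem eq_insert (T : IsTrivalentAt C v e a) {i j k : Fin 3} (hij : i ≠ j) (hik : i ≠ k)
    (hjk : j ≠ k) :
    C = insert (e j) (insert (e k) (insert (e i) {f ∈ C | v ∉ f.ends})) := by
  refine Set.Subset.antisymm (fun f hf => ?_) ?_
  · by_cases hv : v ∈ f.ends
    · obtain ⟨l, rfl⟩ : f ∈ Set.range e := T.range_eq ▸ ⟨hf, hv⟩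
      rcases eq_or_eq_or_eq_of_ne hij hik hjk l with rfl | rfl | rfl <;> simp
    · exact Or.inr (Or.inr (Or.inr ⟨hf, hv⟩))
  · exact Set.insert_subset (T.mem j) (Set.insert_subset (T.mem k)
      (Set.insert_subset (T.mem i) fun f hf => hf.1))

variable [Finite V]

/-- Moving `v` to a point `w` where two of the three edges at `v` are parallel keeps `C` dependent,
by genericity, and a dependency of the rows at `w` expresses a constraint on `C - v`. -/
theorem re_mul_conj_eq_zero_of_parallel (T : IsTrivalentAt C v e a) (hP : GenericConfig P)
    (hC : (constraintMatroid P).IsCircuit C) {i j k : Fin 3} (hij : i ≠ j) (hik : i ≠ k)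
    (hjk : j ≠ k) {w : ℂ} {r : ℝ} (hr : r ≠ 0)
    (hpar : (e j).unit * (w - P (a j)) = r * ((e i).unit * (w - P (a i))))
    (hnot : ((e i).unit * (w - P (a i)) * conj ((e k).unit * (w - P (a k)))).im ≠ 0)
    {u : V → ℂ} (hu : IsMotion P {f ∈ C | v ∉ f.ends} u) :
    ((e i).unit * (w - P (a i)) * conj (u (a i) - u (a j))).re = 0 := by
  classical
  by_contra hne
  let Q := Function.update P v w
  have hQv : Q v = w := Function.update_self ..
  have hQa (l : Fin 3) : Q (a l) = P (a l) := Function.update_of_ne (T.ne l).symm ..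
  have hind₀ : LinearIndepOn ℝ (constraint Q) {f ∈ C | v ∉ f.ends} := by
    refine LinearIndepOn.congr (linearMatroid_indep.1 (hC.ssubset_indep ?_)) fun f hf =>
      (constraint_update_left hf.2 w).symm
    exact ⟨fun f hf => hf.1, fun h => (h (T.mem i)).2 (T.ends_eq i ▸ Sym2.mem_mk_left ..)⟩
  have hnotQ : ((e i).unit * (Q v - Q (a i)) * conj ((e k).unit * (Q v - Q (a k)))).im ≠ 0 := by
    rwa [hQv, hQa, hQa]
  have hind := linearIndepOn_insert_insert hind₀ (fun f hf => hf.2) (T.ends_eq i) (T.ends_eq k)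
    (T.ne i) (T.ne k) hnotQ
  obtain ⟨x, hx⟩ := exists_isMotion_insert_insert (P := Q) (S := {f ∈ C | v ∉ f.ends}) (u := u)
    (fun f hf => by rw [constraint_update_left hf.2, hu f hf]) (fun f hf => hf.2) (T.ends_eq i)
    (T.ends_eq k) (T.ne i) (T.ne k) hnotQ
  have hxi : ((e i).unit * (w - P (a i)) * conj (x - u (a i))).re = 0 := by
    have := hx (e i) (Or.inr (Or.inl rfl))
    rwa [constraint_apply (T.ends_eq i), hQv, hQa, Function.update_self,
      Function.update_of_ne (T.ne i).symm] at this
  have hxj : constraint Q (e j) (Function.update u v x) ≠ 0 := by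
    rw [constraint_apply (T.ends_eq j), hQv, hQa, hpar, Function.update_self,
      Function.update_of_ne (T.ne j).symm, ← sub_add_sub_cancel x (u (a i)) (u (a j)), map_add,
      mul_add, Complex.add_re, mul_assoc (r : ℂ), mul_assoc (r : ℂ), Complex.re_ofReal_mul,
      Complex.re_ofReal_mul, hxi, mul_zero, zero_add]
    exact mul_ne_zero hr hne
  have hindC := linearIndepOn_insert_of_isMotion hind hx hxj
  rw [← T.eq_insert hij hik hjk] at hindC
  exact hC.not_indep (linearMatroid_indep.2 (hP.linearIndepOn Q C hindC))

theorem re_mul_conj_eq_zero_of_unit_eq (T : IsTrivalentAt C v e a) (hP : GenericConfig P)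
    (hC : (constraintMatroid P).IsCircuit C) {i j k : Fin 3} (hij : i ≠ j) (hik : i ≠ k)
    (hjk : j ≠ k) (huj : (e i).unit = (e j).unit) (huk : (e i).unit = (e k).unit) {u : V → ℂ}
    (hu : IsMotion P {f ∈ C | v ∉ f.ends} u) :
    ((e i).unit * (P (a i) - P (a j)) * conj (u (a i) - u (a j))).re = 0 := by
  have hmid : (P (a i) + P (a j)) / 2 - P (a i) = (-1 / 2 : ℝ) * (P (a i) - P (a j)) := by
    push_cast; ring
  have h := T.re_mul_conj_eq_zero_of_parallel hP hC hij hik hjk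
    (w := (P (a i) + P (a j)) / 2) (r := -1) (by norm_num) (by rw [huj]; push_cast; ring) ?_ hu
  · rw [hmid, mul_left_comm, mul_assoc, Complex.re_ofReal_mul] at h
    exact (mul_eq_zero.1 h).resolve_left (by norm_num)
  · have him := hP.im_ne_zero (T.ne_of_unit_eq hij huj) (T.ne_of_unit_eq hik huk)
      (T.ne_of_unit_eq hjk (huj.symm.trans huk))
    rw [← huk, map_mul, mul_mul_mul_comm, unit_mul_conj_unit, one_mul, hmid,
      show (P (a i) + P (a j)) / 2 - P (a k) =
        P (a i) - P (a k) + (-1 / 2 : ℝ) * (P (a i) - P (a j)) by push_cast; ring,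
      map_add, mul_add, map_mul, Complex.conj_ofReal, mul_assoc, mul_mul_mul_comm,
      ← Complex.ofReal_mul, Complex.mul_conj, ← Complex.ofReal_mul, Complex.add_im,
      Complex.im_ofReal_mul, Complex.ofReal_im, add_zero]
    exact mul_ne_zero (by norm_num) him

/-- The point `w = P (a i) + X` is on the circle with diameter from `P (a i)` to `P (a k)`, by
Thales, which makes the edges `e i` and `e k` of different kinds parallel. -/
theorem re_mul_conj_eq_zero_of_unit_ne (T : IsTrivalentAt C v e a) (hP : GenericConfig P)
    (hC : (constraintMatroid P).IsCircuit C) {i j k : Fin 3} (hij : i ≠ j) (hik : i ≠ k)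
    (hjk : j ≠ k) (huj : (e i).unit = (e j).unit) (huk : (e i).unit ≠ (e k).unit) {t : ℝ}
    (ht : t ≠ 0) {X : ℂ} (hX : X * (1 - t * Complex.I) = P (a k) - P (a i))
    (hXj : (X * conj (P (a i) - P (a j))).im ≠ 0) {u : V → ℂ}
    (hu : IsMotion P {f ∈ C | v ∉ f.ends} u) :
    ((e i).unit * X * conj (u (a i) - u (a k))).re = 0 := by
  obtain ⟨σ, hσ, huσ⟩ : ∃ σ : ℝ, σ ≠ 0 ∧ (e k).unit * Complex.I = σ * (e i).unit := by
    rcases unit_eq_or_eq_mul_I _ _ huk with h | h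
    · exact ⟨1, one_ne_zero, by rw [h, Complex.ofReal_one, one_mul]⟩
    · exact ⟨-1, neg_ne_zero.2 one_ne_zero, by rw [h, Complex.ofReal_neg, Complex.ofReal_one]; ring⟩
  have h := T.re_mul_conj_eq_zero_of_parallel hP hC hik hij hjk.symm (w := P (a i) + X)
    (r := σ * t) (mul_ne_zero hσ ht) ?_ ?_ hu
  · rwa [add_sub_cancel_left] at h
  · push_cast
    linear_combination (e k).unit * hX + t * X * huσ
  · rwa [← huj, map_mul, mul_mul_mul_comm, unit_mul_conj_unit, one_mul, add_sub_cancel_left,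
      add_sub_right_comm, map_add, mul_add, Complex.add_im, Complex.mul_conj X, Complex.ofReal_im,
      add_zero]

theorem eq_of_unit_ne (T : IsTrivalentAt C v e a) (hP : GenericConfig P)
    (hC : (constraintMatroid P).IsCircuit C) {i j k : Fin 3} (hij : i ≠ j) (hik : i ≠ k)
    (hjk : j ≠ k) (huj : (e i).unit = (e j).unit) (huk : (e i).unit ≠ (e k).unit)
    {u : V → ℂ} (hu : IsMotion P {f ∈ C | v ∉ f.ends} u) : u (a i) = u (a k) := by
  by_cases hak : a i = a k
  · rw [hak]
  set A := P (a k) - P (a i) with hA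
  have hA0 : A ≠ 0 := hP.sub_ne_zero (Ne.symm hak)
  set Z := A * conj (P (a i) - P (a j)) with hZ
  have hZre : Z.re ≠ 0 := by
    rw [hZ, hA, ← neg_sub, neg_mul, Complex.neg_re]
    exact neg_ne_zero.2 (hP.re_ne_zero hak (T.ne_of_unit_eq hij huj))
  have hcircle (t : ℝ) (ht : t ≠ 0) (hZt : Z.im + t * Z.re ≠ 0) :
      ((e i).unit * (A * (1 + t * Complex.I)) * conj (u (a i) - u (a k))).re = 0 := by
    have hden : (1 + t ^ 2 : ℝ) ≠ 0 := by positivity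
    have hscale (W : ℂ) : (((1 + t ^ 2)⁻¹ : ℝ) * W).re = 0 ↔ W.re = 0 := by
      rw [Complex.re_ofReal_mul, mul_eq_zero, or_iff_right (inv_ne_zero hden)]
    have h := T.re_mul_conj_eq_zero_of_unit_ne hP hC hij hik hjk huj huk ht
      (X := ((1 + t ^ 2)⁻¹ : ℝ) * (A * (1 + t * Complex.I))) ?_ ?_ hu
    · rwa [mul_left_comm, mul_assoc, hscale] at h
    · have hdenC : (1 + t ^ 2 : ℂ) ≠ 0 := by exact_mod_cast hden
      push_cast
      field_simp
      linear_combination -(A * t ^ 2) * Complex.I_sq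
    · rw [mul_assoc, mul_right_comm, ← hZ, Complex.im_ofReal_mul]
      refine mul_ne_zero (inv_ne_zero hden) ?_
      convert hZt using 1
      simp
      ring
  obtain ⟨t, ht, ht₁, ht₂⟩ : ∃ t : ℝ, t ≠ 0 ∧ Z.im + t * Z.re ≠ 0 ∧ Z.im + (-t : ℝ) * Z.re ≠ 0 := by
    refine ⟨(|Z.im| + 1) / Z.re, div_ne_zero (by positivity) hZre, fun h => ?_, fun h => ?_⟩
    · rw [div_mul_cancel₀ _ hZre] at h
      linarith [neg_abs_le Z.im]
    · rw [neg_mul, div_mul_cancel₀ _ hZre] at h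
      linarith [le_abs_self Z.im]
  refine sub_eq_zero.1 (eq_zero_of_re_mul_conj_eq_zero ?_ (hcircle t ht ht₁)
    (hcircle (-t) (neg_ne_zero.2 ht) ht₂))
  rw [map_mul, mul_mul_mul_comm, unit_mul_conj_unit, one_mul, map_mul, mul_mul_mul_comm,
    Complex.mul_conj, Complex.im_ofReal_mul]
  refine mul_ne_zero (Complex.normSq_pos.2 hA0).ne' ?_
  have : ((1 + t * Complex.I) * conj (1 + (-t : ℝ) * Complex.I)).im = 2 * t := by
    simp
    ring
  rw [this]
  exact mul_ne_zero two_ne_zero ht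

end IsTrivalentAt

namespace MixedEdge

variable {V : Type*} {P : V → ℂ}

/-- The infinitesimal similarity `x ↦ t + z P x` of a configuration: a translation, a dilation and a
rotation, the last two combined in the complex factor `z`. -/
def similarity (P : V → ℂ) (t z : ℂ) (x : V) : ℂ := t + z * P x

theorem constraint_congr_right {u w : V → ℂ} {e : MixedEdge V} (h : ∀ x ∈ e.ends, u x = w x) :
    constraint P e u = constraint P e w :=
  constraint_congr fun x hx y hy => ⟨rfl, by rw [h x hx, h y hy]⟩

theorem constraint_similarity {e : MixedEdge V} {a b : V} (h : e.ends = s(a, b)) (t z : ℂ) :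
    constraint P e (similarity P t z) = Complex.normSq (P a - P b) * (e.unit * conj z).re := by
  rw [constraint_apply h, show similarity P t z a - similarity P t z b = z * (P a - P b) by
    unfold similarity; ring, map_mul, mul_mul_mul_comm, Complex.mul_conj, mul_comm,
    Complex.re_ofReal_mul]

theorem similarity_injective {a b : V} (hab : P a - P b ≠ 0) {t z t' z' : ℂ}
    (ha : similarity P t z a = similarity P t' z' a)
    (hb : similarity P t z b = similarity P t' z' b) : t = t' ∧ z = z' := by
  unfold similarity at ha hb
  obtain rfl : z = z' := mul_right_cancel₀ hab (by linear_combination ha - hb)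
  exact ⟨add_right_cancel ha, rfl⟩

theorem exists_similarity_eq {a b : V} (hab : P a - P b ≠ 0) (u : V → ℂ) :
    ∃ t z, u a = similarity P t z a ∧ u b = similarity P t z b := by
  refine ⟨u a - (u a - u b) / (P a - P b) * P a, (u a - u b) / (P a - P b), ?_, ?_⟩
  · unfold similarity; ring
  · unfold similarity; field_simp; ring

theorem eq_zero_of_re_unit_mul_conj_eq_zero {e f : MixedEdge V} (hef : e.unit ≠ f.unit) {z : ℂ}
    (he : (e.unit * conj z).re = 0) (hf : (f.unit * conj z).re = 0) : z = 0 := by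
  refine eq_zero_of_re_mul_conj_eq_zero ?_ he hf
  rcases unit_eq_or_eq_mul_I e f hef with h | h <;> rw [h]
  · rw [mul_right_comm, unit_mul_conj_unit, one_mul, Complex.I_im]
    exact one_ne_zero
  · rw [neg_mul, mul_right_comm, unit_mul_conj_unit, one_mul, Complex.neg_im, Complex.I_im]
    exact neg_ne_zero.2 one_ne_zero

theorem exists_eq_ofReal_mul_of_re_unit_mul_conj_eq_zero (e : MixedEdge V) {z : ℂ}
    (h : (e.unit * conj z).re = 0) : ∃ r : ℝ, z = r * (Complex.I * e.unit) := by
  rcases unit_eq_or e with he | he <;> rw [he] at h ⊢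
  · rw [one_mul, Complex.conj_re] at h
    exact ⟨z.im, Complex.ext (by simp [h]) (by simp)⟩
  · exact ⟨z.re, Complex.ext (by simp) (by simpa using h)⟩

theorem verts_insert (e : MixedEdge V) (S : Set (MixedEdge V)) :
    verts (insert e S) = {x | x ∈ e.ends} ∪ verts S := by
  ext x
  simp [verts]

theorem verts_iUnion {ι : Sort*} (S : ι → Set (MixedEdge V)) :
    verts (⋃ i, S i) = ⋃ i, verts (S i) := by
  ext x
  simp only [verts, Set.mem_iUnion, Set.mem_ofPred_eq]
  exact ⟨fun ⟨e, ⟨i, hi⟩, hx⟩ => ⟨i, e, hi, hx⟩, fun ⟨i, e, hi, hx⟩ => ⟨e, ⟨i, hi⟩, hx⟩⟩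

theorem verts_union (S T : Set (MixedEdge V)) : verts (S ∪ T) = verts S ∪ verts T := by
  rw [Set.union_eq_iUnion, verts_iUnion, Set.union_eq_iUnion]
  exact Set.iUnion_congr fun b => by cases b <;> rfl

/-- Every infinitesimal motion of the edges in `S` acts on their ends as an infinitesimal
similarity. -/
def IsSimilarityRigid (P : V → ℂ) (S : Set (MixedEdge V)) : Prop :=
  ∀ u, IsMotion P S u → ∃ t z, (verts S).EqOn u (similarity P t z)

end MixedEdge

namespace GenericConfig

open MixedEdge

variable {V : Type*} {P : V → ℂ}

theorem re_unit_mul_conj_eq_zero (hP : GenericConfig P) {e : MixedEdge V} (he : ¬ e.ends.IsDiag)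
    {u : V → ℂ} {t z : ℂ} (hu : ∀ x ∈ e.ends, u x = similarity P t z x)
    (h : constraint P e u = 0) : (e.unit * conj z).re = 0 := by
  obtain ⟨a, b, hab⟩ := exists_ends_eq e
  rw [constraint_congr_right hu, constraint_similarity hab, mul_eq_zero] at h
  refine h.resolve_left (Complex.normSq_pos.2 (hP.sub_ne_zero ?_)).ne'
  rwa [hab, Sym2.mk_isDiag_iff] at he

theorem isSimilarityRigid_singleton (hP : GenericConfig P) {e : MixedEdge V}
    (he : ¬ e.ends.IsDiag) : IsSimilarityRigid P {e} := by
  obtain ⟨a, b, hab⟩ := exists_ends_eq e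
  intro u _
  obtain ⟨t, z, ha, hb⟩ := exists_similarity_eq (u := u) (hP.sub_ne_zero (a := a) (b := b)
    (by rwa [hab, Sym2.mk_isDiag_iff] at he))
  refine ⟨t, z, ?_⟩
  rintro x ⟨_, rfl, hx⟩
  rw [hab, Sym2.mem_iff] at hx
  rcases hx with rfl | rfl <;> assumption

/-- The condition `hz` excludes dilations if `e` is a length edge, and rotations if `e` is a
direction edge. -/
theorem eq_of_similarity_triangle (hP : GenericConfig P) (e : MixedEdge V) {a : Fin 3 → V}
    (ha : Function.Injective a) {u : V → ℂ} {t z : Fin 3 → ℂ}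
    (hz : ∀ i, (e.unit * conj (z i)).re = 0)
    (hleft : ∀ i, u (a i) = similarity P (t i) (z i) (a i))
    (hright : ∀ i, u (a (i + 1)) = similarity P (t i) (z i) (a (i + 1))) (i : Fin 3) :
    t i = t 0 ∧ z i = z 0 := by
  choose r hr using fun i => exists_eq_ofReal_mul_of_re_unit_mul_conj_eq_zero e (hz i)
  have h01 : t 0 + z 0 * P (a 1) = t 1 + z 1 * P (a 1) := (hright 0).symm.trans (hleft 1)
  have h12 : t 1 + z 1 * P (a 2) = t 2 + z 2 * P (a 2) := (hright 1).symm.trans (hleft 2)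
  have h20 : t 2 + z 2 * P (a 0) = t 0 + z 0 * P (a 0) := (hright 2).symm.trans (hleft 0)
  simp only [hr] at h01 h12 h20
  have hsum :
      (r 0 - r 2 : ℝ) * (P (a 1) - P (a 0)) + (r 2 - r 1 : ℝ) * (P (a 1) - P (a 2)) = 0 := by
    refine (mul_eq_zero.1 (?_ : Complex.I * e.unit * _ = 0)).resolve_left
      (mul_ne_zero Complex.I_ne_zero (unit_ne_zero e))
    push_cast
    linear_combination h01 + h12 + h20
  have hr20 : r 0 - r 2 = 0 := by
    have h := congrArg (fun y => (y * conj (P (a 1) - P (a 2))).im) hsum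
    simp only [add_mul, mul_assoc, Complex.mul_conj, Complex.add_im, Complex.im_ofReal_mul,
      Complex.ofReal_im, mul_zero, add_zero, zero_mul, Complex.zero_im] at h
    exact (mul_eq_zero.1 h).resolve_right (hP.im_ne_zero (ha.ne (by decide)) (ha.ne (by decide))
      (ha.ne (by decide)))
  have hr21 : r 2 - r 1 = 0 := by
    rw [hr20, Complex.ofReal_zero, zero_mul, zero_add] at hsum
    exact_mod_cast (mul_eq_zero.1 hsum).resolve_right (hP.sub_ne_zero (ha.ne (by decide)))
  have hr01 : r 1 = r 0 := by linarith
  have hr02 : r 2 = r 0 := by linarith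
  rw [hr01] at h01
  rw [hr02] at h20
  match i with
  | 0 => exact ⟨rfl, rfl⟩
  | 1 => exact ⟨add_right_cancel h01.symm, by rw [hr, hr01, ← hr]⟩
  | 2 => exact ⟨add_right_cancel h20, by rw [hr, hr02, ← hr]⟩

variable [Finite V]

theorem exists_similarity_of_mem_closure (hP : GenericConfig P) {g : MixedEdge V}
    (hg : ¬ g.ends.IsDiag) {S : Set (MixedEdge V)} (hcl : g ∈ (constraintMatroid P).closure S)
    (ih : ∀ C, (constraintMatroid P).IsCircuit C → C ⊆ insert g S → IsSimilarityRigid P C) :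
    ∃ B ⊆ S, ∀ u, IsMotion P B u → ∃ t z, (verts B ∪ {x | x ∈ g.ends}).EqOn u (similarity P t z) ∧
      (g.unit * conj z).re = 0 := by
  obtain ⟨B, hBS, hcl, hB⟩ : ∃ B ⊆ S, g ∈ (constraintMatroid P).closure B ∧
      IsSimilarityRigid P (insert g B) := by
    by_cases hgS : g ∈ S
    · refine ⟨{g}, Set.singleton_subset_iff.2 hgS, mem_closure_iff.2 fun u hu => hu g rfl, ?_⟩
      rw [Set.pair_eq_singleton]
      exact hP.isSimilarityRigid_singleton hg
    · obtain ⟨C, hCS, hC, hgC⟩ := (Matroid.mem_closure_iff_exists_isCircuit hgS).1 hcl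
      refine ⟨C \ {g}, Set.sdiff_singleton_subset_iff.2 hCS,
        hC.mem_closure_sdiff_singleton_of_mem hgC, ?_⟩
      rw [Set.insert_sdiff_self_of_mem hgC]
      exact ih C hC hCS
  refine ⟨B, hBS, fun u hu => ?_⟩
  have hgu := mem_closure_iff.1 hcl u hu
  obtain ⟨t, z, h⟩ := hB u (hu.insert hgu)
  rw [verts_insert, Set.union_comm] at h
  exact ⟨t, z, h, hP.re_unit_mul_conj_eq_zero hg (fun x hx => h (Or.inr hx)) hgu⟩

theorem exists_eqOn_const_of_forall_isMotion (hP : GenericConfig P) {S : Set (MixedEdge V)}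
    {a b : V} (hab : ∀ u, IsMotion P S u → u a = u b)
    (ih : ∀ g : MixedEdge V, ¬ g.ends.IsDiag → ∀ C, (constraintMatroid P).IsCircuit C →
      C ⊆ insert g S → IsSimilarityRigid P C) :
    ∃ B ⊆ S, ∀ u, IsMotion P B u → (insert a (verts B)).EqOn u fun _ => u b := by
  by_cases hne : a = b
  · refine ⟨∅, Set.empty_subset S, fun u _ => ?_⟩
    rintro x (rfl | ⟨_, h, _⟩)
    · rw [hne]
    · exact h.elim
  have hB (g : MixedEdge V) (hg : g.ends = s(a, b)) :=
    hP.exists_similarity_of_mem_closure (g := g) (S := S) (by rwa [hg, Sym2.mk_isDiag_iff])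
      (mem_closure_iff.2 fun u hu => by
        rw [constraint_apply hg, hab u hu, sub_self, map_zero, mul_zero, Complex.zero_re])
      (ih g (by rwa [hg, Sym2.mk_isDiag_iff]))
  obtain ⟨B₁, hB₁, h₁⟩ := hB (Sum.inl s(a, b)) rfl
  obtain ⟨B₂, hB₂, h₂⟩ := hB (Sum.inr s(a, b)) rfl
  refine ⟨B₁ ∪ B₂, Set.union_subset hB₁ hB₂, fun u hu => ?_⟩
  obtain ⟨t, z, h₁, hz₁⟩ := h₁ u (hu.mono Set.subset_union_left)
  obtain ⟨t', z', h₂, hz₂⟩ := h₂ u (hu.mono Set.subset_union_right)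
  have ha : a ∈ s(a, b) := Sym2.mem_mk_left a b
  have hb : b ∈ s(a, b) := Sym2.mem_mk_right a b
  obtain ⟨rfl, rfl⟩ := similarity_injective (hP.sub_ne_zero hne)
    ((h₁ (Or.inr ha)).symm.trans (h₂ (Or.inr ha))) ((h₁ (Or.inr hb)).symm.trans (h₂ (Or.inr hb)))
  obtain rfl := eq_zero_of_re_unit_mul_conj_eq_zero (unit_inl_ne_unit_inr _ _) hz₁ hz₂
  have hconst {x : V} (h : u x = similarity P t 0 x) : u x = u b := by
    rw [h, h₁ (Or.inr hb), similarity, similarity, zero_mul, zero_mul]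
  rw [verts_union]
  rintro x (rfl | hx | hx)
  · exact hconst (h₁ (Or.inr ha))
  · exact hconst (h₁ (Or.inl hx))
  · exact hconst (h₂ (Or.inl hx))

end GenericConfig

namespace IsTrivalentAt

open MixedEdge

variable {V : Type*} {P : V → ℂ} {C : Set (MixedEdge V)} {v : V} {e : Fin 3 → MixedEdge V}
  {a : Fin 3 → V}

theorem eq_similarity (T : IsTrivalentAt C v e a) (hP : GenericConfig P) {i j : Fin 3}
    (hij : i ≠ j) {u : V → ℂ} (hi : constraint P (e i) u = 0) (hj : constraint P (e j) u = 0)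
    {t z : ℂ} (ha : ∀ l, u (a l) = similarity P t z (a l))
    (hz : ∀ l, ((e l).unit * conj z).re = 0) : u v = similarity P t z v := by
  have hdiff (l : Fin 3) (hl : constraint P (e l) u = 0) :
      ((e l).unit * (P v - P (a l)) * conj (u v - similarity P t z v)).re = 0 := by
    have : constraint P (e l) (u - similarity P t z) = 0 := by
      rw [map_sub, hl, constraint_similarity (T.ends_eq l), hz, mul_zero, sub_zero]
    rwa [constraint_apply (T.ends_eq l), Pi.sub_apply, Pi.sub_apply, ha, sub_self, sub_zero] at this
  exact sub_eq_zero.1 (eq_zero_of_re_mul_conj_eq_zero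
    (hP.im_unit_mul_sub_mul_conj_ne_zero (T.ends_eq i) (T.ends_eq j) (T.ne i) (T.ne j)
      (T.injective.ne hij)) (hdiff i hi) (hdiff j hj))

variable [Finite V]

theorem isSimilarityRigid_of_subset (T : IsTrivalentAt C v e a) (hP : GenericConfig P)
    (hC : (constraintMatroid P).IsCircuit C) {F : Set (MixedEdge V)}
    (hFC : F ⊆ {f ∈ C | v ∉ f.ends})
    (hF : ∀ u, IsMotion P F u → ∃ t z, (verts F ∪ Set.range a).EqOn u (similarity P t z) ∧
      ∀ i, ((e i).unit * conj z).re = 0) : IsSimilarityRigid P C := by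
  have hcl : e 2 ∈ (constraintMatroid P).closure (insert (e 1) (insert (e 0) F)) := by
    refine mem_closure_iff.2 fun u hu => ?_
    rw [isMotion_insert, isMotion_insert] at hu
    obtain ⟨t, z, h, hz⟩ := hF u hu.2.2
    have hends : ∀ x ∈ (e 2).ends, u x = similarity P t z x := by
      rw [T.ends_eq]
      intro x hx
      rcases Sym2.mem_iff.1 hx with rfl | rfl
      · exact T.eq_similarity hP (by decide) hu.1 hu.2.1 (fun l => h (Or.inr ⟨l, rfl⟩)) hz
      · exact h (Or.inr ⟨2, rfl⟩)
    rw [constraint_congr_right hends, constraint_similarity (T.ends_eq 2), hz, mul_zero]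
  have hsub : insert (e 2) (insert (e 1) (insert (e 0) F)) ⊆ C :=
    Set.insert_subset (T.mem 2) (Set.insert_subset (T.mem 1) (Set.insert_subset (T.mem 0)
      fun f hf => (hFC hf).1))
  have hnot : e 2 ∉ insert (e 1) (insert (e 0) F) := by
    rintro (h | h | h)
    · exact T.injective.ne (by decide) h
    · exact T.injective.ne (by decide) h
    · exact (hFC h).2 (T.ends_eq 2 ▸ Sym2.mem_mk_left v (a 2))
  have hdep : ¬ (constraintMatroid P).Indep (insert (e 2) (insert (e 1) (insert (e 0) F))) :=
    fun hI => hI.notMem_closure_sdiff_of_mem (Set.mem_insert ..)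
      (by rwa [Set.insert_sdiff_self_of_notMem hnot])
  intro u hu
  have hCF := hC.eq_of_not_indep_subset hdep hsub
  obtain ⟨t, z, h, hz⟩ := hF u fun f hf => hu f (hFC hf).1
  have hv := T.eq_similarity hP (i := 0) (j := 1) (by decide) (hu _ (T.mem 0)) (hu _ (T.mem 1))
    (fun l => h (Or.inr ⟨l, rfl⟩)) hz
  have hends (l : Fin 3) : {x | x ∈ (e l).ends}.EqOn u (similarity P t z) := fun x hx => by
    rw [Set.mem_ofPred_eq, T.ends_eq, Sym2.mem_iff] at hx
    rcases hx with rfl | rfl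
    · exact hv
    · exact h (Or.inr ⟨l, rfl⟩)
  refine ⟨t, z, ?_⟩
  rw [← hCF, verts_insert, verts_insert, verts_insert]
  exact (hends 2).union ((hends 1).union ((hends 0).union fun x hx => h (Or.inl hx)))

theorem isSimilarityRigid_of_unit_eq (T : IsTrivalentAt C v e a) (hP : GenericConfig P)
    (hC : (constraintMatroid P).IsCircuit C)
    (ih : ∀ g : MixedEdge V, ¬ g.ends.IsDiag → ∀ C', (constraintMatroid P).IsCircuit C' →
      C' ⊆ insert g {f ∈ C | v ∉ f.ends} → IsSimilarityRigid P C')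
    (hunit : ∀ i j, (e i).unit = (e j).unit) : IsSimilarityRigid P C := by
  have ha : Function.Injective a := fun i j h => by
    by_contra hij
    exact T.ne_of_unit_eq hij (hunit i j) h
  have hne : ∀ i : Fin 3, i ≠ i + 1 ∧ i ≠ i + 2 ∧ i + 1 ≠ i + 2 := by decide
  have hside (i : Fin 3) : ∃ B ⊆ {f ∈ C | v ∉ f.ends}, ∀ u, IsMotion P B u → ∃ t z,
      (verts B ∪ {x | x ∈ s(a i, a (i + 1))}).EqOn u (similarity P t z) ∧
        ((e 0).unit * conj z).re = 0 := by
    obtain ⟨g, hgu, hg⟩ := exists_unit_eq_ends_eq (e i) s(a i, a (i + 1))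
    have hdiag : ¬ g.ends.IsDiag := by
      rw [hg, Sym2.mk_isDiag_iff]
      exact ha.ne (hne i).1
    rw [← hg, hunit 0 i, ← hgu]
    refine hP.exists_similarity_of_mem_closure hdiag (mem_closure_iff.2 fun u hu => ?_)
      (ih g hdiag)
    rw [constraint_apply hg, hgu]
    exact T.re_mul_conj_eq_zero_of_unit_eq hP hC (hne i).1 (hne i).2.1 (hne i).2.2 (hunit _ _)
      (hunit _ _) hu
  choose B hBC hB using hside
  refine T.isSimilarityRigid_of_subset hP hC (Set.iUnion_subset hBC) fun u hu => ?_
  choose t z h hz using fun i => hB i u (hu.mono (Set.subset_iUnion B i))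
  have hleft (i : Fin 3) := h i (Or.inr (Sym2.mem_mk_left ..))
  have htz := hP.eq_of_similarity_triangle (e 0) ha hz hleft
    fun i => h i (Or.inr (Sym2.mem_mk_right ..))
  have hsim (i : Fin 3) {x : V} (hx : u x = similarity P (t i) (z i) x) :
      u x = similarity P (t 0) (z 0) x := by rwa [(htz i).1, (htz i).2] at hx
  refine ⟨t 0, z 0, ?_, fun i => hunit 0 i ▸ hz 0⟩
  rw [verts_iUnion]
  rintro x (hx | ⟨i, rfl⟩)
  · obtain ⟨i, hx⟩ := Set.mem_iUnion.1 hx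
    exact hsim i (h i (Or.inl hx))
  · exact hsim i (hleft i)

theorem isSimilarityRigid_of_unit_ne (T : IsTrivalentAt C v e a) (hP : GenericConfig P)
    (hC : (constraintMatroid P).IsCircuit C)
    (ih : ∀ g : MixedEdge V, ¬ g.ends.IsDiag → ∀ C', (constraintMatroid P).IsCircuit C' →
      C' ⊆ insert g {f ∈ C | v ∉ f.ends} → IsSimilarityRigid P C')
    {i j k : Fin 3} (hij : i ≠ j) (hik : i ≠ k) (hjk : j ≠ k) (huj : (e i).unit = (e j).unit)
    (huk : (e i).unit ≠ (e k).unit) : IsSimilarityRigid P C := by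
  obtain ⟨B₁, hB₁, h₁⟩ := hP.exists_eqOn_const_of_forall_isMotion
    (fun u hu => T.eq_of_unit_ne hP hC hij hik hjk huj huk hu) ih
  obtain ⟨B₂, hB₂, h₂⟩ := hP.exists_eqOn_const_of_forall_isMotion
    (fun u hu => T.eq_of_unit_ne hP hC hij.symm hjk hik huj.symm (huj ▸ huk) hu) ih
  refine T.isSimilarityRigid_of_subset hP hC (Set.union_subset hB₁ hB₂) fun u hu =>
    ⟨u (a k), 0, fun x hx => ?_, fun l => by rw [map_zero, mul_zero, Complex.zero_re]⟩
  replace h₁ := h₁ u (hu.mono Set.subset_union_left)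
  replace h₂ := h₂ u (hu.mono Set.subset_union_right)
  rw [similarity, zero_mul, add_zero]
  rw [verts_union] at hx
  rcases hx with (hx | hx) | ⟨l, rfl⟩
  · exact h₁ (Or.inr hx)
  · exact h₂ (Or.inr hx)
  · rcases eq_or_eq_or_eq_of_ne hij hik hjk l with rfl | rfl | rfl
    · exact h₁ (Or.inl rfl)
    · exact h₂ (Or.inl rfl)
    · rfl

end IsTrivalentAt

theorem GenericConfig.isSimilarityRigid_of_isCircuit {V : Type*} [Finite V] {P : V → ℂ}
    (hP : GenericConfig P) {C : Set (MixedEdge V)}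
    (hC : (MixedEdge.constraintMatroid P).IsCircuit C) (hdiag : ∀ e ∈ C, ¬ e.ends.IsDiag) :
    MixedEdge.IsSimilarityRigid P C := by
  induction hn : C.ncard using Nat.strong_induction_on generalizing C with | _ n ih
  subst hn
  obtain ⟨v, hv⟩ := hP.exists_ncard_eq_three_of_isCircuit hC hdiag
  obtain ⟨e, a, T⟩ := IsTrivalentAt.exists_of_ncard_eq_three hdiag hv
  have hsmall : {f ∈ C | v ∉ f.ends}.ncard + 3 = C.ncard := by
    rw [← hv, show {f ∈ C | v ∉ f.ends} = C \ {f ∈ C | v ∈ f.ends} by ext; simp]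
    exact Set.ncard_sdiff_add_ncard_of_subset fun f hf => hf.1
  have ih (g : MixedEdge V) (hg : ¬ g.ends.IsDiag) (C' : Set (MixedEdge V))
      (hC' : (MixedEdge.constraintMatroid P).IsCircuit C')
      (hsub : C' ⊆ insert g {f ∈ C | v ∉ f.ends}) : MixedEdge.IsSimilarityRigid P C' := by
    refine ih C'.ncard ?_ hC' (fun e he => ?_) rfl
    · have := Set.ncard_le_ncard hsub
      have := Set.ncard_insert_le g {f ∈ C | v ∉ f.ends}
      omega
    · rcases hsub he with rfl | he
      · exact hg
      · exact hdiag e he.1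
  obtain ⟨i, j, hij, h⟩ := Fintype.exists_ne_map_eq_of_card_lt (fun i => Sum.isLeft (e i)) (by simp)
  have huj := MixedEdge.unit_eq_of_isLeft_eq h
  have hthird : ∀ i j : Fin 3, ∃ k, i ≠ k ∧ j ≠ k := by decide
  obtain ⟨k, hik, hjk⟩ := hthird i j
  by_cases huk : (e i).unit = (e k).unit
  · have hunit (l : Fin 3) : (e l).unit = (e i).unit := by
      rcases eq_or_eq_or_eq_of_ne hij hik hjk l with rfl | rfl | rfl
      exacts [rfl, huj.symm, huk.symm]
    exact T.isSimilarityRigid_of_unit_eq hP hC ih fun l m => (hunit l).trans (hunit m).symm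
  · exact T.isSimilarityRigid_of_unit_ne hP hC ih hij hik hjk huj huk

section CircuitComponent

variable {α : Type*} {M : Matroid α} {e f g : α}

theorem exists_mem_notMem_of_subset_union_sdiff {C C₁ C₂ : Set α} (hC : M.IsCircuit C)
    (h₁ : M.IsCircuit C₁) (hsub : C ⊆ (C₁ ∪ C₂) \ {g}) (hg : g ∈ C₁) :
    ∃ x ∈ C, x ∈ C₂ ∧ x ∉ C₁ := by
  by_contra! hx
  have hCC₁ : C ⊆ C₁ := fun x hxC => by
    by_contra hx₁
    exact hx₁ (hx x hxC ((hsub hxC).1.resolve_left hx₁))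
  exact (hsub (hC.eq_of_subset_isCircuit h₁ hCC₁ ▸ hg)).2 rfl

theorem exists_isCircuit_of_inter_nonempty [Finite α] {C₁ C₂ : Set α} (h₁ : M.IsCircuit C₁)
    (h₂ : M.IsCircuit C₂) (he : e ∈ C₁) (hf : f ∈ C₂) (hne : (C₁ ∩ C₂).Nonempty) :
    ∃ C, M.IsCircuit C ∧ e ∈ C ∧ f ∈ C := by
  induction hn : (C₁ ∪ C₂).ncard using Nat.strong_induction_on generalizing C₁ C₂ with | _ n ih
  subst hn
  by_cases hf₁ : f ∈ C₁
  · exact ⟨C₁, h₁, he, hf₁⟩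
  by_cases he₂ : e ∈ C₂
  · exact ⟨C₂, h₂, he₂, hf⟩
  obtain ⟨g, hg₁, hg₂⟩ := hne
  obtain ⟨C₃, hC₃, h₃, he₃⟩ := h₁.strong_elimination h₂ hg₁ hg₂ he he₂
  obtain ⟨C₄, hC₄, h₄, hf₄⟩ := h₂.strong_elimination h₁ hg₂ hg₁ hf hf₁
  obtain ⟨x, hx₃, hx₂, hx₁⟩ := exists_mem_notMem_of_subset_union_sdiff h₃ h₁ hC₃ hg₁
  obtain ⟨y, hy₄, hy₁, -⟩ := exists_mem_notMem_of_subset_union_sdiff h₄ h₂ hC₄ hg₂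
  rw [Set.union_comm] at hC₄
  by_cases hx₄ : x ∈ C₄
  · refine ih _ (Set.ncard_lt_ncard ⟨Set.union_subset (hC₃.trans Set.sdiff_subset)
      (hC₄.trans Set.sdiff_subset), fun h => ?_⟩) h₃ h₄ he₃ hf₄ ⟨x, hx₃, hx₄⟩ rfl
    exact (h (Or.inl hg₁)).elim (fun h => (hC₃ h).2 rfl) fun h => (hC₄ h).2 rfl
  · exact ih _ (Set.ncard_lt_ncard ⟨Set.union_subset Set.subset_union_left
      (hC₄.trans Set.sdiff_subset), fun h => (h (Or.inr hx₂)).elim hx₁ hx₄⟩) h₁ h₄ he hf₄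
      ⟨y, hy₁, hy₄⟩ rfl

/-- Two elements of a matroid are equal or lie in a common circuit. This is the equivalence relation
whose classes are the connected components of the matroid. -/
def CircuitLinked (M : Matroid α) (e f : α) : Prop := e = f ∨ ∃ C, M.IsCircuit C ∧ e ∈ C ∧ f ∈ C

theorem CircuitLinked.symm (h : CircuitLinked M e f) : CircuitLinked M f e :=
  h.imp Eq.symm fun ⟨C, hC, he, hf⟩ => ⟨C, hC, hf, he⟩

theorem CircuitLinked.trans [Finite α] (h₁ : CircuitLinked M e f) (h₂ : CircuitLinked M f g) :
    CircuitLinked M e g := by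
  rcases h₁ with rfl | ⟨C, hC, he, hf⟩
  · exact h₂
  rcases h₂ with rfl | ⟨C', hC', hf', hg⟩
  · exact Or.inr ⟨C, hC, he, hf⟩
  · exact Or.inr (exists_isCircuit_of_inter_nonempty hC hC' he hg ⟨f, hf, hf'⟩)

/-- The connected component of the element `e` in the matroid `M`. -/
def circuitComponent (M : Matroid α) (e : α) : Set α := {f ∈ M.E | CircuitLinked M e f}

theorem circuitComponent_subset_ground (M : Matroid α) (e : α) : circuitComponent M e ⊆ M.E :=
  fun _ hf => hf.1

theorem mem_circuitComponent_self (he : e ∈ M.E) : e ∈ circuitComponent M e := ⟨he, Or.inl rfl⟩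

theorem exists_isCircuit_of_isConnected (hM : M.IsConnected) (hE : M.E.Nontrivial) (he : e ∈ M.E) :
    ∃ C, M.IsCircuit C ∧ e ∈ C := by
  obtain ⟨f, hf, hfe⟩ := hE.exists_ne e
  obtain ⟨C, hC, heC, -⟩ := hM e he f hf hfe.symm
  exact ⟨C, hC, heC⟩

theorem circuitComponent_eq_ground_of_isConnected (hM : M.IsConnected) (he : e ∈ M.E) :
    circuitComponent M e = M.E :=
  (circuitComponent_subset_ground M e).antisymm fun f hf =>
    ⟨hf, or_iff_not_imp_left.2 (hM e he f hf)⟩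

variable [Finite α]

theorem isConnected_of_circuitComponent_eq_ground (h : circuitComponent M e = M.E) :
    M.IsConnected := fun _ hf _ hg =>
  (((h.symm ▸ hf : _ ∈ circuitComponent M e).2.symm).trans
    (h.symm ▸ hg : _ ∈ circuitComponent M e).2).resolve_left

theorem circuitComponent_eq_of_mem (hf : f ∈ circuitComponent M e) :
    circuitComponent M f = circuitComponent M e :=
  Set.ext fun _ => and_congr_right fun _ => ⟨hf.2.trans, hf.2.symm.trans⟩

theorem subset_circuitComponent_of_isCircuit {C : Set α} (hC : M.IsCircuit C) (hfC : f ∈ C)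
    (hf : f ∈ circuitComponent M e) : C ⊆ circuitComponent M e :=
  fun _ hg => ⟨hC.subset_ground hg, hf.2.trans (Or.inr ⟨C, hC, hfC, hg⟩)⟩

theorem circuitComponent_subset_closure_of_isBase {B : Set α} (hB : M.IsBase B) (e : α) :
    circuitComponent M e ⊆ M.closure (B ∩ circuitComponent M e) := by
  intro f hf
  by_cases hfB : f ∈ B
  · exact M.mem_closure_of_mem' ⟨hfB, hf⟩ hf.1
  · have hC := hB.fundCircuit_isCircuit hf.1 hfB
    have hfC := M.mem_fundCircuit f B
    refine M.closure_subset_closure (fun g hg => ?_) (hC.mem_closure_sdiff_singleton_of_mem hfC)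
    exact ⟨(M.fundCircuit_subset_insert f B hg.1).resolve_left hg.2,
      subset_circuitComponent_of_isCircuit hC hfC hf hg.1⟩

theorem ncard_eq_sum_ncard_inter_circuitComponent {B : Set α} (hB : B ⊆ M.E)
    {s : Finset (Set α)} (hs : (s : Set (Set α)) = circuitComponent M '' M.E) :
    B.ncard = ∑ K ∈ s, (B ∩ K).ncard := by
  classical
  have := Fintype.ofFinite α
  have hmaps : ∀ e ∈ B.toFinset, circuitComponent M e ∈ s := fun e he =>
    Finset.mem_coe.1 (hs ▸ ⟨e, hB (Set.mem_toFinset.1 he), rfl⟩)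
  rw [Set.ncard_eq_toFinset_card', Finset.card_eq_sum_card_fiberwise hmaps]
  refine Finset.sum_congr rfl fun K hK => ?_
  obtain ⟨e, -, rfl⟩ : K ∈ circuitComponent M '' M.E := hs ▸ Finset.mem_coe.2 hK
  rw [← Set.ncard_coe_finset]
  congr 1
  ext f
  simp only [Finset.coe_filter, Set.mem_toFinset, Set.mem_ofPred_eq, Set.mem_inter_iff]
  exact and_congr_right fun hf =>
    ⟨fun h => h ▸ mem_circuitComponent_self (hB hf), circuitComponent_eq_of_mem⟩

end CircuitComponent

namespace MixedGraph

variable {V : Type*} {G : MixedGraph V}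

theorem inl_mem_edges {s : Sym2 V} : (Sum.inl s : MixedEdge V) ∈ G.edges ↔ s ∈ G.D.edgeSet := by
  simp [edges]

theorem inr_mem_edges {s : Sym2 V} : (Sum.inr s : MixedEdge V) ∈ G.edges ↔ s ∈ G.L.edgeSet := by
  simp [edges]

theorem not_isDiag_of_mem_edges {e : MixedEdge V} (he : e ∈ G.edges) : ¬ e.ends.IsDiag := by
  rcases he with ⟨s, hs, rfl⟩ | ⟨s, hs, rfl⟩
  · exact G.D.not_isDiag_of_mem_edgeSet hs
  · exact G.L.not_isDiag_of_mem_edgeSet hs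

theorem edges_deleteEdge (G : MixedGraph V) (e : MixedEdge V) :
    (G.deleteEdge e).edges = G.edges \ {e} := by
  ext f
  rcases f with s | s <;> simp [edges, deleteEdge]

theorem adj_iff_exists_mem_edges {a b : V} :
    (G.D ⊔ G.L).Adj a b ↔ ∃ e ∈ G.edges, e.ends = s(a, b) := by
  rw [SimpleGraph.sup_adj, ← SimpleGraph.mem_edgeSet, ← SimpleGraph.mem_edgeSet, ← inl_mem_edges,
    ← inr_mem_edges]
  refine ⟨fun h => h.elim (fun h => ⟨_, h, rfl⟩) fun h => ⟨_, h, rfl⟩, ?_⟩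
  rintro ⟨s | s, hs, h⟩
  · exact Or.inl (h ▸ hs)
  · exact Or.inr (h ▸ hs)

theorem rigidityMatroid_eq [Finite V] (G : MixedGraph V) {p : V → Plane} (hp : IsGeneric p) :
    G.rigidityMatroid = (MixedEdge.constraintMatroid (toComplex ∘ p)).restrict G.edges := by
  have hq := (exists_isGeneric V).choose_spec
  refine Matroid.ext_indep rfl fun I _ => ?_
  rw [Matroid.restrict_indep_iff, linearMatroid_indep, and_comm]
  trans I ⊆ G.edges ∧ LinearIndepOn ℝ (MixedEdge.row (exists_isGeneric V).choose) I
  · simp [rigidityMatroid, frameworkMatroid]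
  rw [MixedEdge.linearIndepOn_row_iff]
  exact and_congr_right fun _ =>
    ⟨hp.genericConfig.linearIndepOn _ _, hq.genericConfig.linearIndepOn _ _⟩

end MixedGraph

namespace MixedEdge

variable {V : Type*} {P : V → ℂ} {K : Set (MixedEdge V)}

theorem eq_inl_or_eq_inr_of_ends_eq {e : MixedEdge V} {s : Sym2 V} (h : e.ends = s) :
    e = Sum.inl s ∨ e = Sum.inr s := by
  rcases e with t | t
  · exact Or.inl (congrArg Sum.inl h)
  · exact Or.inr (congrArg Sum.inr h)

theorem exists_unit_ne_ends_eq (e : MixedEdge V) : ∃ g : MixedEdge V, e.unit ≠ g.unit ∧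
    g.ends = e.ends := by
  rcases e with s | s
  · exact ⟨Sum.inr s, unit_inl_ne_unit_inr s s, rfl⟩
  · exact ⟨Sum.inl s, (unit_inl_ne_unit_inr s s).symm, rfl⟩

theorem IsSimilarityRigid.insert_of_subset_verts (hK : IsSimilarityRigid P K)
    {g : MixedEdge V} (hg : {x | x ∈ g.ends} ⊆ verts K) : IsSimilarityRigid P (insert g K) := by
  rw [IsSimilarityRigid, verts_insert, Set.union_eq_right.2 hg]
  exact fun u hu => hK u (isMotion_insert.1 hu).2

theorem IsSimilarityRigid.eq_of_isMotion (hK : IsSimilarityRigid P K) (hP : GenericConfig P)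
    {e f : MixedEdge V} (he : e ∈ K) (hf : f ∈ K) (hed : ¬ e.ends.IsDiag) (hfd : ¬ f.ends.IsDiag)
    (hef : e.unit ≠ f.unit) {u : V → ℂ} (hu : IsMotion P K u) {x y : V} (hx : x ∈ verts K)
    (hy : y ∈ verts K) : u x = u y := by
  obtain ⟨t, z, h⟩ := hK u hu
  have hz {g : MixedEdge V} (hg : g ∈ K) (hgd : ¬ g.ends.IsDiag) : (g.unit * conj z).re = 0 :=
    hP.re_unit_mul_conj_eq_zero hgd (fun x hx => h ⟨g, hg, hx⟩) (hu g hg)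
  obtain rfl := eq_zero_of_re_unit_mul_conj_eq_zero hef (hz he hed) (hz hf hfd)
  rw [h hx, h hy, similarity, similarity, zero_mul, zero_mul]

variable [Finite V]

theorem IsSimilarityRigid.two_mul_ncard_verts_le_add_two (hK : IsSimilarityRigid P K)
    (hP : GenericConfig P) {e f : MixedEdge V} (he : e ∈ K) (hf : f ∈ K) (hed : ¬ e.ends.IsDiag)
    (hfd : ¬ f.ends.IsDiag) (hef : e.unit ≠ f.unit) {B : Set (MixedEdge V)}
    (hB : K ⊆ (constraintMatroid P).closure B) : 2 * (verts K).ncard ≤ B.ncard + 2 :=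
  two_mul_ncard_le_of_forall_isMotion (P := P) fun u hu _ hx _ hy =>
    hK.eq_of_isMotion hP he hf hed hfd hef (fun _ hg => mem_closure_iff.1 (hB hg) u hu) hx hy

theorem IsSimilarityRigid.two_mul_ncard_verts_le_add_three (hK : IsSimilarityRigid P K)
    (hP : GenericConfig P) {e : MixedEdge V} (he : e ∈ K) (hed : ¬ e.ends.IsDiag)
    {B : Set (MixedEdge V)} (hB : K ⊆ (constraintMatroid P).closure B) :
    2 * (verts K).ncard ≤ B.ncard + 3 := by
  obtain ⟨g, heg, hg⟩ := exists_unit_ne_ends_eq e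
  have hends : {x | x ∈ g.ends} ⊆ verts K := fun x hx => ⟨e, he, hg ▸ hx⟩
  have hcl : insert g K ⊆ (constraintMatroid P).closure (insert g B) :=
    Set.insert_subset ((constraintMatroid P).mem_closure_of_mem' (Set.mem_insert g B) trivial)
      (hB.trans (Matroid.closure_subset_closure _ (Set.subset_insert g B)))
  have hle := (hK.insert_of_subset_verts hends).two_mul_ncard_verts_le_add_two hP
    (Set.mem_insert_of_mem g he) (Set.mem_insert g K) hed (hg ▸ hed) heg hcl
  rw [verts_insert, Set.union_eq_right.2 hends] at hle
  have := Set.ncard_insert_le g B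
  omega

end MixedEdge

namespace GenericConfig

open MixedEdge

variable {V : Type*} [Finite V] {P : V → ℂ}

theorem three_le_ncard_verts_of_isCircuit (hP : GenericConfig P) {C : Set (MixedEdge V)}
    (hC : (constraintMatroid P).IsCircuit C) (hdiag : ∀ e ∈ C, ¬ e.ends.IsDiag) :
    3 ≤ (verts C).ncard := by
  by_contra! hlt
  obtain ⟨e, he⟩ := hC.nonempty
  obtain ⟨v, b, hvb⟩ := exists_ends_eq e
  have hne : v ≠ b := by simpa only [hvb, Sym2.mk_isDiag_iff] using hdiag e he
  have hverts : {v, b} = verts C :=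
    Set.eq_of_subset_of_ncard_le (Set.pair_subset (mem_verts_left he hvb) (mem_verts_right he hvb))
      (by rw [Set.ncard_pair hne]; omega)
  have hsub : {g ∈ C | v ∈ g.ends} ⊆ {Sum.inl s(v, b), Sum.inr s(v, b)} := by
    rintro g ⟨hg, hvg⟩
    obtain ⟨x, hx, hvx⟩ := exists_ends_eq_of_mem hvg (hdiag g hg)
    have hxC : x ∈ ({v, b} : Set V) := hverts ▸ mem_verts_right hg hx
    rw [← hxC.resolve_left hvx.symm]
    exact eq_inl_or_eq_inr_of_ends_eq hx
  have := hP.three_le_ncard_of_isCircuit hC hdiag (mem_verts_left he hvb)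
  have := Set.ncard_le_ncard hsub
  rw [Set.ncard_pair Sum.inl_ne_inr] at this
  omega

variable {E : Set (MixedEdge V)} {e : MixedEdge V}

theorem isSimilarityRigid_circuitComponent (hP : GenericConfig P)
    (hdiag : ∀ e ∈ E, ¬ e.ends.IsDiag) (he : e ∈ E) :
    IsSimilarityRigid P (circuitComponent ((constraintMatroid P).restrict E) e) := by
  intro u hu
  obtain ⟨a, b, hab⟩ := exists_ends_eq e
  have hPab : P a - P b ≠ 0 := hP.sub_ne_zero
    (by simpa only [hab, Sym2.mk_isDiag_iff] using hdiag e he)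
  obtain ⟨t, z, ha, hb⟩ := exists_similarity_eq hPab u
  refine ⟨t, z, ?_⟩
  rintro x ⟨f, ⟨hfE, rfl | ⟨C, hC, heC, hfC⟩⟩, hx⟩
  · rw [hab, Sym2.mem_iff] at hx
    rcases hx with rfl | rfl <;> assumption
  · have hCK := subset_circuitComponent_of_isCircuit hC heC (mem_circuitComponent_self he)
    rw [Matroid.restrict_isCircuit_iff] at hC
    obtain ⟨t', z', h⟩ := hP.isSimilarityRigid_of_isCircuit hC.1 (fun g hg => hdiag g (hC.2 hg)) u
      (hu.mono hCK)
    obtain ⟨rfl, rfl⟩ := similarity_injective hPab (ha.symm.trans (h (mem_verts_left heC hab)))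
      (hb.symm.trans (h (mem_verts_right heC hab)))
    exact h ⟨f, hfC, hx⟩

end GenericConfig

theorem surjective_pi_of_linearIndependent {K E ι : Type*} [Field K] [AddCommGroup E] [Module K E]
    [Finite ι] {f : ι → Module.Dual K E} (hf : LinearIndependent K f) :
    Function.Surjective (LinearMap.pi f) := by
  classical
  have := Fintype.ofFinite ι
  rw [← LinearMap.dualMap_injective_iff, injective_iff_map_eq_zero]
  intro φ hφ
  have happly (x : ι → K) := LinearMap.pi_apply_eq_sum_univ φ x
  have hcoeff := Fintype.linearIndependent_iff.1 hf (fun i => φ fun j => if i = j then 1 else 0) <|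
    LinearMap.ext fun x => by
      rw [LinearMap.sum_apply, ← LinearMap.congr_fun hφ x, LinearMap.dualMap_apply, happly]
      exact Finset.sum_congr rfl fun i _ => mul_comm _ _
  refine LinearMap.ext fun x => ?_
  rw [happly, Finset.sum_eq_zero fun i _ => by rw [hcoeff i, smul_zero], LinearMap.zero_apply]

theorem exists_ofReal_mul_eq_iff {z w : ℂ} :
    (w ≠ 0 → ∃ c : ℝ, z = c * w) ↔ (z * conj w).im = 0 := by
  constructor
  · intro h
    rcases eq_or_ne w 0 with rfl | hw
    · simp
    · obtain ⟨c, rfl⟩ := h hw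
      rw [mul_assoc, Complex.mul_conj, ← Complex.ofReal_mul, Complex.ofReal_im]
  · intro h hw
    refine ⟨(z * conj w).re / Complex.normSq w, ?_⟩
    have hre : ((z * conj w).re : ℂ) = z * conj w := Complex.ext rfl h.symm
    rw [Complex.ofReal_div, hre, ← Complex.mul_conj, mul_div_mul_right _ _ ((map_ne_zero _).2 hw),
      div_mul_cancel₀ _ hw]

theorem exists_ofReal_mul_sub_eq_add_iff {M U : ℂ} :
    (M - U ≠ 0 → ∃ c : ℝ, M + U = c * (M - U)) ↔ (-Complex.I * M * conj U).re = 0 := by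
  rw [exists_ofReal_mul_eq_iff]
  simp only [Complex.mul_im, Complex.mul_re, Complex.add_re, Complex.add_im, Complex.sub_re,
    Complex.sub_im, Complex.conj_re, Complex.conj_im, Complex.neg_re, Complex.neg_im, Complex.I_re,
    Complex.I_im]
  constructor <;> intro h <;> linarith

theorem norm_add_eq_norm_sub_iff_re_mul_conj_eq_zero {M U : ℂ} :
    ‖M + U‖ = ‖M - U‖ ↔ (M * conj U).re = 0 := by
  rw [← sq_eq_sq₀ (norm_nonneg _) (norm_nonneg _), Complex.sq_norm, Complex.sq_norm,
    Complex.normSq_add, Complex.normSq_sub]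
  constructor <;> intro h <;> linarith

namespace MixedEdge

open Filter Topology

variable {V : Type*} {P : V → ℂ} {S : Set (MixedEdge V)}

/-- The edges in `S` are infinitesimally rigid at `P`: their only infinitesimal motions at `P` are
the translations. -/
def IsInfinitesimallyRigid (P : V → ℂ) (S : Set (MixedEdge V)) : Prop :=
  ∀ u, IsMotion P S u → ∀ x y, u x = u y

section Topology

variable [Finite V]

theorem continuous_toContinuousLinearMap_constraint (e : MixedEdge V) :
    Continuous fun P : V → ℂ => LinearMap.toContinuousLinearMap (constraint P e) := by
  have := Fintype.ofFinite V
  rw [continuous_clm_apply]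
  exact continuous_constraint_apply e

theorem eventually_linearIndepOn_constraint (hS : LinearIndepOn ℝ (constraint P) S) :
    ∀ᶠ Q in 𝓝 P, LinearIndepOn ℝ (constraint Q) S := by
  have := Fintype.ofFinite V
  let toCLM : Module.Dual ℝ (V → ℂ) ≃ₗ[ℝ] (V → ℂ) →L[ℝ] ℝ := LinearMap.toContinuousLinearMap
  have hiff (Q : V → ℂ) : LinearIndependent ℝ (toCLM ∘ fun e : S => constraint Q e) ↔
      LinearIndepOn ℝ (constraint Q) S := toCLM.toLinearMap.linearIndependent_iff toCLM.ker
  have hcont : Continuous fun Q : V → ℂ => toCLM ∘ fun e : S => constraint Q e :=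
    continuous_pi fun e => continuous_toContinuousLinearMap_constraint e.1
  exact (hcont.continuousAt.eventually ((hiff P).2 hS).eventually).mono fun Q => (hiff Q).1

/-- The linear map whose kernel consists of the infinitesimal motions of `S` at `P` that fix the
vertex `x₀`. -/
noncomputable def pinnedRigidityMap (P : V → ℂ) (S : Set (MixedEdge V)) (x₀ : V) :
    (V → ℂ) →L[ℝ] (S → ℝ) × ℂ :=
  (ContinuousLinearMap.pi fun e : S => LinearMap.toContinuousLinearMap (constraint P e)).prod
    (ContinuousLinearMap.proj x₀)

theorem isInfinitesimallyRigid_iff_injective (x₀ : V) :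
    IsInfinitesimallyRigid P S ↔ Function.Injective (pinnedRigidityMap P S x₀) := by
  rw [injective_iff_map_eq_zero]
  constructor
  · intro h u hu
    have hmot : IsMotion P S u := fun e he => congrFun (congrArg Prod.fst hu) ⟨e, he⟩
    exact funext fun x => (h u hmot x x₀).trans (congrArg Prod.snd hu)
  · intro h u hu
    have hconst := h (fun x => u x - u x₀) (Prod.ext (funext fun e => ?_) (sub_self _))
    · have (x : V) : u x = u x₀ := sub_eq_zero.1 (congrFun hconst x)
      exact fun x y => (this x).trans (this y).symm
    · exact (constraint_congr fun _ _ _ _ => ⟨rfl, sub_sub_sub_cancel_right _ _ _⟩).trans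
        (hu e e.2)

theorem IsInfinitesimallyRigid.eventually (h : IsInfinitesimallyRigid P S) :
    ∀ᶠ Q in 𝓝 P, IsInfinitesimallyRigid Q S := by
  have := Fintype.ofFinite V
  have := Fintype.ofFinite S
  rcases isEmpty_or_nonempty V with _ | ⟨⟨x₀⟩⟩
  · exact Eventually.of_forall fun _ _ _ x => isEmptyElim x
  simp_rw [isInfinitesimallyRigid_iff_injective x₀] at h ⊢
  have hcont : Continuous fun Q => pinnedRigidityMap Q S x₀ :=
    continuous_clm_apply.2 fun u =>
      (continuous_pi fun e : S => continuous_constraint_apply e.1 u).prodMk continuous_const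
  exact hcont.continuousAt.eventually (ContinuousLinearMap.isOpen_injective.mem_nhds h)

omit [Finite V] in
theorem constraint_sub_self_apply {u : V → ℂ} {e : MixedEdge V} {a b : V}
    (h : e.ends = s(a, b)) :
    constraint (P - u) e u = constraint P e u - e.unit.re * ‖u a - u b‖ ^ 2 := by
  rw [constraint_apply h, constraint_apply h, Pi.sub_apply, Pi.sub_apply, sub_sub_sub_comm, mul_sub,
    sub_mul, Complex.sub_re, mul_assoc e.unit (u a - u b), Complex.mul_conj', ← Complex.ofReal_pow,
    Complex.re_mul_ofReal]

theorem hasStrictFDerivAt_constraint_sub_self (P : V → ℂ) (e : MixedEdge V) :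
    HasStrictFDerivAt (fun u => constraint (P - u) e u)
      (LinearMap.toContinuousLinearMap (constraint P e)) 0 := by
  have := Fintype.ofFinite V
  obtain ⟨a, b, hab⟩ := exists_ends_eq e
  simp_rw [constraint_sub_self_apply hab]
  have hsq : HasStrictFDerivAt (fun u : V → ℂ => ‖u a - u b‖ ^ 2) (0 : (V → ℂ) →L[ℝ] ℝ) 0 := by
    have := (hasStrictFDerivAt_norm_sq (((0 : V → ℂ) a) - (0 : V → ℂ) b)).comp (0 : V → ℂ)
      (ContinuousLinearMap.proj (R := ℝ) (φ := fun _ : V => ℂ) a -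
        ContinuousLinearMap.proj b).hasStrictFDerivAt
    simpa using this
  have hder := (LinearMap.toContinuousLinearMap (constraint P e)).hasStrictFDerivAt.sub
    (hsq.const_mul e.unit.re)
  rwa [smul_zero, sub_zero] at hder

theorem exists_isMotion_sub_self {e : MixedEdge V}
    (hS : LinearIndepOn ℝ (constraint P) (insert e S)) (he : e ∉ S) {N : Set (V → ℂ)}
    (hN : N ∈ 𝓝 0) : ∃ u ∈ N, IsMotion (P - u) S u ∧ constraint (P - u) e u ≠ 0 := by
  classical
  have := Fintype.ofFinite V
  let T : Set (MixedEdge V) := insert e S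
  have := Fintype.ofFinite T
  let H (u : V → ℂ) (g : T) : ℝ := constraint (P - u) g u
  let H' : (V → ℂ) →L[ℝ] (T → ℝ) :=
    ContinuousLinearMap.pi fun g : T => LinearMap.toContinuousLinearMap (constraint P g)
  have hH : HasStrictFDerivAt H H' 0 :=
    hasStrictFDerivAt_pi.2 fun g => hasStrictFDerivAt_constraint_sub_self P g
  have hsurj : H'.range = ⊤ := LinearMap.range_eq_top.2 (surjective_pi_of_linearIndependent hS)
  have himage : H '' N ∈ 𝓝 (0 : T → ℝ) := by
    rw [show (0 : T → ℝ) = H 0 from funext fun g => (map_zero _).symm,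
      ← hH.map_nhds_eq_of_surj hsurj]
    exact image_mem_map hN
  let e' : T := ⟨e, Set.mem_insert e S⟩
  have htarget : Tendsto (fun s : ℝ => (Pi.single e' s : T → ℝ)) (𝓝[≠] 0) (𝓝 0) :=
    ((continuous_single e').tendsto' 0 0 (Pi.single_zero e')).mono_left nhdsWithin_le_nhds
  obtain ⟨s, ⟨u, huN, hu⟩, hs⟩ := ((htarget.eventually himage).and self_mem_nhdsWithin).exists
  refine ⟨u, huN, fun g hg => ?_, fun h0 => hs ?_⟩
  · let g' : T := ⟨g, Set.mem_insert_of_mem e hg⟩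
    have hge : g' ≠ e' := fun h => he (show e ∈ S from Subtype.mk.inj h ▸ hg)
    have := congrFun hu g'
    rwa [Pi.single_eq_of_ne hge] at this
  · have := congrFun hu e'
    rw [Pi.single_eq_same] at this
    exact this.symm.trans h0

end Topology

end MixedEdge

theorem GenericConfig.isMotion_of_isBasis {V : Type*} [Finite V] {P : V → ℂ} (hP : GenericConfig P)
    {B S : Set (MixedEdge V)} (hB : (MixedEdge.constraintMatroid P).IsBasis B S) {Q u : V → ℂ}
    (hQ : LinearIndepOn ℝ (MixedEdge.constraint Q) B) (hu : MixedEdge.IsMotion Q B u) :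
    MixedEdge.IsMotion Q S u := by
  intro e he
  by_contra hne
  have hind := hP.linearIndepOn Q _ (MixedEdge.linearIndepOn_insert_of_isMotion hQ hu hne)
  exact hne (hu e (hB.mem_of_insert_indep he (linearMatroid_indep.2 hind)))

namespace MixedGraph

open MixedEdge Filter Topology

variable {V : Type*} {G : MixedGraph V} {p q : V → Plane} {m u : V → ℂ}

theorem toComplex_sub_eq_add (hp : ∀ v, toComplex (p v) = m v + u v) (a b : V) :
    toComplex (p a - p b) = (m a - m b) + (u a - u b) := by
  rw [map_sub, hp, hp, add_sub_add_comm]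

theorem toComplex_sub_eq_sub (hq : ∀ v, toComplex (q v) = m v - u v) (a b : V) :
    toComplex (q a - q b) = (m a - m b) - (u a - u b) := by
  rw [map_sub, hq, hq, sub_sub_sub_comm]

/- The averaging trick: the vectors `M + U` and `M - U` are parallel iff `M` and `U` are, and they
have the same length iff `M` and `U` are orthogonal. -/
theorem equivalent_iff_isMotion (hp : ∀ v, toComplex (p v) = m v + u v)
    (hq : ∀ v, toComplex (q v) = m v - u v) : G.Equivalent p q ↔ IsMotion m G.edges u := by
  have hdir (a b : V) : (q a ≠ q b → ∃ c : ℝ, p a - p b = c • (q a - q b)) ↔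
      constraint m (Sum.inl s(a, b)) u = 0 := by
    rw [constraint_apply (a := a) (b := b) rfl, unit_inl, ← exists_ofReal_mul_sub_eq_add_iff,
      ← toComplex_sub_eq_add hp, ← toComplex_sub_eq_sub hq, ne_eq, ne_eq,
      toComplex.map_eq_zero_iff, sub_eq_zero]
    simp_rw [← Complex.real_smul, ← map_smul, toComplex.injective.eq_iff]
  have hlen (a b : V) : ‖p a - p b‖ = ‖q a - q b‖ ↔ constraint m (Sum.inr s(a, b)) u = 0 := by
    rw [constraint_apply (a := a) (b := b) rfl, unit_inr, one_mul,
      ← norm_add_eq_norm_sub_iff_re_mul_conj_eq_zero, ← toComplex_sub_eq_add hp,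
      ← toComplex_sub_eq_sub hq, toComplex.norm_map, toComplex.norm_map]
  simp only [Equivalent, hdir, hlen]
  constructor
  · rintro ⟨hD, hL⟩ _ (⟨s, hs, rfl⟩ | ⟨s, hs, rfl⟩) <;> induction s with | _ a b
    · exact hD a b hs
    · exact hL a b hs
  · exact fun h => ⟨fun _ _ hab => h _ (inl_mem_edges.2 hab),
      fun _ _ hab => h _ (inr_mem_edges.2 hab)⟩

theorem constraint_eq_zero_of_pointCongruent (hp : ∀ v, toComplex (p v) = m v + u v)
    (hq : ∀ v, toComplex (q v) = m v - u v) (h : PointCongruent p q) (e : MixedEdge V) :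
    constraint m e u = 0 := by
  obtain ⟨a, b, hab⟩ := exists_ends_eq e
  rw [constraint_apply hab]
  rcases h with h | h
  · have hU := congrArg toComplex (h a b)
    rw [toComplex_sub_eq_add hp, toComplex_sub_eq_sub hq] at hU
    rw [show u a - u b = 0 by linear_combination hU / 2, map_zero, mul_zero, Complex.zero_re]
  · have hM := congrArg toComplex (h a b)
    rw [toComplex_sub_eq_add hp, toComplex_sub_eq_sub hq] at hM
    rw [show m a - m b = 0 by linear_combination hM / 2, mul_zero, zero_mul, Complex.zero_re]

variable [Finite V]

theorem frameworkRigid_of_isInfinitesimallyRigid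
    (h : IsInfinitesimallyRigid (toComplex ∘ p) G.edges) : G.FrameworkRigid p := by
  have := Fintype.ofFinite V
  obtain ⟨ε, hε, hball⟩ := Metric.eventually_nhds_iff.1 h.eventually
  refine ⟨ε, hε, fun q hpq hlt => Or.inl fun a b => toComplex.injective ?_⟩
  let m v := (toComplex (p v) + toComplex (q v)) / 2
  let u v := (toComplex (p v) - toComplex (q v)) / 2
  have hp v : toComplex (p v) = m v + u v := by simp only [m, u]; ring
  have hq v : toComplex (q v) = m v - u v := by simp only [m, u]; ring
  have hm : IsInfinitesimallyRigid m G.edges := by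
    refine hball ((dist_pi_lt_iff hε).2 fun v => ?_)
    rw [dist_eq_norm, Function.comp_apply, hp, sub_add_cancel_left, norm_neg]
    simp only [u]
    rw [← map_sub, norm_div, toComplex.norm_map, Complex.norm_ofNat]
    exact (half_le_self (norm_nonneg _)).trans_lt (hlt v)
  rw [toComplex_sub_eq_add hp, toComplex_sub_eq_sub hq,
    hm u ((equivalent_iff_isMotion hp hq).1 hpq) a b, sub_self, add_zero, sub_zero]

/- Near `p`, the constraints of a basis of the edges stay independent, so the equation
`constraint (p - u) b u = 0` can be solved for these edges with a small `u` that is not a motion of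
`e`. The configurations `p` and `p - 2u` are then equivalent, and not congruent. -/
theorem FrameworkRigid.mem_closure_edges (hG : G.FrameworkRigid p) (hp : IsGeneric p)
    (e : MixedEdge V) : e ∈ (constraintMatroid (toComplex ∘ p)).closure G.edges := by
  have := Fintype.ofFinite V
  set P := toComplex ∘ p with hP
  obtain ⟨ε, hε, hrig⟩ := hG
  obtain ⟨B, hB⟩ := (constraintMatroid P).exists_isBasis G.edges
  by_contra hcl
  rw [← hB.closure_eq_closure] at hcl
  have hind : LinearIndepOn ℝ (constraint P) (insert e B) :=
    linearMatroid_indep.1 ((hB.indep.notMem_closure_iff_of_notMem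
      fun heB => hcl (Matroid.mem_closure_of_mem _ heB)).1 hcl)
  have hnhds : ∀ᶠ u : V → ℂ in 𝓝 0, dist u 0 < ε / 2 ∧ LinearIndepOn ℝ (constraint (P - u)) B :=
    (Metric.eventually_nhds_iff.2 ⟨ε / 2, half_pos hε, fun _ h => h⟩).and
      (((continuous_sub_left P).tendsto' 0 P (sub_zero P)).eventually
        (eventually_linearIndepOn_constraint (hind.mono (Set.subset_insert e B))))
  obtain ⟨u, ⟨hu, hBu⟩, hmot, hne⟩ := exists_isMotion_sub_self hind
    (fun heB => hcl (Matroid.mem_closure_of_mem _ heB)) hnhds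
  have hpu v : toComplex (p v) = (P - u) v + u v := by simp [hP]
  have hqu v : toComplex (toComplex.symm ((P - u) v - u v)) = (P - u) v - u v :=
    toComplex.apply_symm_apply _
  refine hne (constraint_eq_zero_of_pointCongruent hpu hqu (hrig _ ?_ fun v => ?_) e)
  · exact (equivalent_iff_isMotion hpu hqu).2 (hp.genericConfig.isMotion_of_isBasis hB hBu hmot)
  · rw [← toComplex.norm_map, map_sub, hpu, hqu, add_sub_sub_cancel, ← two_mul, norm_mul,
      Complex.norm_ofNat, ← lt_div_iff₀' two_pos]
    exact (norm_le_pi_norm u v).trans_lt (by rwa [dist_zero_right] at hu)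

end MixedGraph

namespace MixedGraph

open MixedEdge

variable {V : Type*} [Finite V] {G : MixedGraph V}

theorem exists_not_isDir_of_isCircuit (hred : ¬ ∃ e, G.EdgeReduction e) {C : Set (MixedEdge V)}
    (hC : G.rigidityMatroid.IsCircuit C) : ∃ f ∈ C, ¬ f.IsDir := by
  by_contra! hdir
  obtain ⟨e, he⟩ := hC.nonempty
  exact hred ⟨e, hdir e he, C, hC, he, hdir⟩

theorem TwoConnected.nontrivial (h : G.TwoConnected) : Nontrivial V :=
  Finite.one_lt_card_iff_nontrivial.1 (by have := h.1; omega)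

theorem TwoConnected.exists_mem_edges (h : G.TwoConnected) (x : V) :
    ∃ e ∈ G.edges, x ∈ e.ends := by
  have := h.nontrivial
  obtain ⟨y, hxy⟩ := h.2.1.preconnected.exists_adj_of_nontrivial x
  obtain ⟨e, he, hends⟩ := adj_iff_exists_mem_edges.1 hxy
  exact ⟨e, he, hends ▸ Sym2.mem_mk_left x y⟩

theorem TwoConnected.nontrivial_edges (h : G.TwoConnected) : G.edges.Nontrivial := by
  have := h.nontrivial
  obtain ⟨e, he, -⟩ := h.exists_mem_edges (Classical.arbitrary V)
  obtain ⟨a, b, hab⟩ := exists_ends_eq e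
  obtain ⟨x, -, hx⟩ : ∃ x ∈ Set.univ, x ∉ ({a, b} : Set V) :=
    Set.exists_mem_notMem_of_ncard_lt_ncard <| calc
      ({a, b} : Set V).ncard ≤ 2 := by
        simpa using Set.ncard_insert_le a {b}
      _ < Nat.card V := h.1
      _ = Set.univ.ncard := (Set.ncard_univ V).symm
  obtain ⟨f, hf, hxf⟩ := h.exists_mem_edges x
  exact ⟨e, he, f, hf, by rintro rfl; exact hx (Sym2.mem_iff.1 (hab ▸ hxf))⟩

theorem isSimilarityRigid_circuitComponent {p : V → Plane} (hp : IsGeneric p) {e : MixedEdge V}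
    (he : e ∈ G.edges) :
    IsSimilarityRigid (toComplex ∘ p) (circuitComponent G.rigidityMatroid e) := by
  rw [G.rigidityMatroid_eq hp]
  exact hp.genericConfig.isSimilarityRigid_circuitComponent (fun _ => not_isDiag_of_mem_edges) he

theorem isCircuit_rigidityMatroid_iff {p : V → Plane} (hp : IsGeneric p) {C : Set (MixedEdge V)} :
    G.rigidityMatroid.IsCircuit C ↔
      (constraintMatroid (toComplex ∘ p)).IsCircuit C ∧ C ⊆ G.edges := by
  rw [G.rigidityMatroid_eq hp, Matroid.restrict_isCircuit_iff (Set.subset_univ _)]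

theorem mem_closure_edges_sdiff_singleton_iff {p : V → Plane} (hp : IsGeneric p) {e : MixedEdge V}
    (he : e ∈ G.edges) : e ∈ (constraintMatroid (toComplex ∘ p)).closure (G.edges \ {e}) ↔
      ∃ C, G.rigidityMatroid.IsCircuit C ∧ e ∈ C := by
  rw [Matroid.mem_closure_iff_exists_isCircuit fun h => h.2 rfl, Set.insert_sdiff_singleton,
    Set.insert_eq_of_mem he]
  simp_rw [isCircuit_rigidityMatroid_iff hp]
  exact exists_congr fun C => by tauto

theorem MConnected.redundantlyRigid (hM : G.MConnected) (hD : G.D ≠ ⊥)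
    (hred : ¬ ∃ e, G.EdgeReduction e) (hconn : G.TwoConnected) : G.RedundantlyRigid := by
  obtain ⟨p, hp⟩ := exists_isGeneric V
  have hcircuit {e} (he : e ∈ G.edges) : ∃ C, G.rigidityMatroid.IsCircuit C ∧ e ∈ C :=
    exists_isCircuit_of_isConnected hM hconn.nontrivial_edges he
  obtain ⟨a, b, hab⟩ := SimpleGraph.ne_bot_iff_exists_adj.1 hD
  have hd : Sum.inl s(a, b) ∈ G.edges := inl_mem_edges.2 hab
  obtain ⟨C, hC, -⟩ := hcircuit hd
  obtain ⟨f, hfC, hf⟩ := exists_not_isDir_of_isCircuit hred hC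
  have hrigid := isSimilarityRigid_circuitComponent hp hd
  rw [circuitComponent_eq_ground_of_isConnected hM hd] at hrigid
  refine ⟨p, hp, fun e he => frameworkRigid_of_isInfinitesimallyRigid fun u hu x y => ?_⟩
  rw [edges_deleteEdge] at hu
  have hmotion : IsMotion (toComplex ∘ p) G.edges u := by
    rw [← Set.insert_eq_of_mem he, ← Set.insert_sdiff_singleton]
    exact hu.insert <|
      mem_closure_iff.1 ((mem_closure_edges_sdiff_singleton_iff hp he).2 (hcircuit he)) u hu
  exact hrigid.eq_of_isMotion hp.genericConfig hd (hC.subset_ground hfC)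
    (not_isDiag_of_mem_edges hd) (not_isDiag_of_mem_edges (hC.subset_ground hfC))
    (unit_ne_of_isDir ⟨_, rfl⟩ hf) hmotion (hconn.exists_mem_edges x) (hconn.exists_mem_edges y)

end MixedGraph

section DoubleCounting

open Finset

variable {V κ : Type*}

theorem sum_ncard_eq_sum_card_filter_mem [Fintype V] (s : Finset κ) (A : κ → Set V)
    [∀ v k, Decidable (v ∈ A k)] : ∑ k ∈ s, (A k).ncard = ∑ v, #{k ∈ s | v ∈ A k} := by
  simp_rw [card_filter]
  rw [sum_comm]
  refine sum_congr rfl fun k _ => ?_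
  rw [← card_filter, ← Set.ncard_coe_finset, coe_filter_univ]
  rfl

theorem two_add_card_filter_exists_ne_le {s : Finset κ} {p : κ → Prop} [DecidablePred p]
    [DecidablePred fun k => ∃ j ∈ s, j ≠ k ∧ p j] (hs : ∃ k ∈ s, p k) :
    2 + #{k ∈ s | p k ∧ ∃ j ∈ s, j ≠ k ∧ p j} ≤ 2 * #{k ∈ s | p k} := by
  obtain ⟨k, hk, hpk⟩ := hs
  have hpos : 0 < #{k ∈ s | p k} := card_pos.2 ⟨k, mem_filter.2 ⟨hk, hpk⟩⟩
  rw [← filter_filter]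
  by_cases hne : ∃ j ∈ s.filter p, ∃ i ∈ s, i ≠ j ∧ p i
  · obtain ⟨j, hj, i, hi, hij, hpi⟩ := hne
    have : 1 < #{k ∈ s | p k} := one_lt_card.2 ⟨i, mem_filter.2 ⟨hi, hpi⟩, j, hj, hij⟩
    calc _ ≤ 2 + #{k ∈ s | p k} := Nat.add_le_add_left (card_filter_le _ _) 2
      _ ≤ _ := by omega
  · rw [filter_eq_empty_iff.2 fun j hj h => hne ⟨j, hj, h⟩, card_empty]
    omega

theorem two_mul_card_add_sum_ncard_inter_le [Finite V] {s : Finset κ} {A : κ → Set V}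
    (hA : ⋃ k ∈ s, A k = Set.univ) :
    2 * Nat.card V + ∑ k ∈ s, (A k ∩ {v | ∃ j ∈ s, j ≠ k ∧ v ∈ A j}).ncard ≤
      ∑ k ∈ s, 2 * (A k).ncard := by
  classical
  have := Fintype.ofFinite V
  rw [← mul_sum, sum_ncard_eq_sum_card_filter_mem, sum_ncard_eq_sum_card_filter_mem, mul_sum,
    Nat.card_eq_fintype_card, ← card_univ, card_eq_sum_ones, mul_sum, ← sum_add_distrib]
  refine sum_le_sum fun v _ => two_add_card_filter_exists_ne_le ?_
  simpa only [Set.mem_iUnion, exists_prop] using hA.ge (Set.mem_univ v)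

end DoubleCounting

namespace MixedGraph

open MixedEdge

variable {V : Type*} {G : MixedGraph V} {K : Set (MixedEdge V)}

/-- The subgraph of `G` that is formed by a set of edges and their end vertices. -/
def Subgraph.ofEdges (G : MixedGraph V) (K : Set (MixedEdge V)) (hK : K ⊆ G.edges) :
    G.Subgraph where
  verts := MixedEdge.verts K
  D := SimpleGraph.fromEdgeSet {s | Sum.inl s ∈ K}
  L := SimpleGraph.fromEdgeSet {s | Sum.inr s ∈ K}
  D_le _ _ h := inl_mem_edges.1 (hK ((SimpleGraph.fromEdgeSet_adj _).1 h).1)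
  L_le _ _ h := inr_mem_edges.1 (hK ((SimpleGraph.fromEdgeSet_adj _).1 h).1)
  D_verts _ _ h := ⟨mem_verts_left ((SimpleGraph.fromEdgeSet_adj _).1 h).1 rfl,
    mem_verts_right ((SimpleGraph.fromEdgeSet_adj _).1 h).1 rfl⟩
  L_verts _ _ h := ⟨mem_verts_left ((SimpleGraph.fromEdgeSet_adj _).1 h).1 rfl,
    mem_verts_right ((SimpleGraph.fromEdgeSet_adj _).1 h).1 rfl⟩

theorem isUnion_ofEdges (hK : K ⊆ G.edges) (hV : verts K ∪ verts (G.edges \ K) = Set.univ) :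
    G.IsUnion (Subgraph.ofEdges G K hK) (Subgraph.ofEdges G (G.edges \ K) Set.sdiff_subset) := by
  have hunion (ι : Sym2 V → MixedEdge V) : ι ⁻¹' K ∪ ι ⁻¹' (G.edges \ K) = ι ⁻¹' G.edges := by
    rw [← Set.preimage_union, Set.union_sdiff_cancel hK]
  have hD : Sum.inl ⁻¹' G.edges = G.D.edgeSet := Set.ext fun _ => inl_mem_edges
  have hL : Sum.inr ⁻¹' G.edges = G.L.edgeSet := Set.ext fun _ => inr_mem_edges
  refine ⟨hV, ?_, ?_⟩
  · rw [← SimpleGraph.fromEdgeSet_edgeSet G.D, ← hD, ← hunion, SimpleGraph.fromEdgeSet_union]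
    rfl
  · rw [← SimpleGraph.fromEdgeSet_edgeSet G.L, ← hL, ← hunion, SimpleGraph.fromEdgeSet_union]
    rfl

variable [Finite V]

theorem TwoConnected.verts_union_verts_sdiff (h : G.TwoConnected) (K : Set (MixedEdge V)) :
    verts K ∪ verts (G.edges \ K) = Set.univ := by
  refine Set.eq_univ_of_forall fun x => ?_
  obtain ⟨e, he, hx⟩ := h.exists_mem_edges x
  by_cases heK : e ∈ K
  · exact Or.inl ⟨e, heK, hx⟩
  · exact Or.inr ⟨e, ⟨he, heK⟩, hx⟩

theorem TwoConnected.two_le_ncard_inter (h : G.TwoConnected) (hK : 2 ≤ (verts K).ncard)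
    (hK' : 2 ≤ (verts (G.edges \ K)).ncard) : 2 ≤ (verts K ∩ verts (G.edges \ K)).ncard := by
  by_contra! hlt
  have := h.nontrivial
  obtain ⟨y, hy⟩ := (Set.ncard_le_one_iff_subset_singleton).1 (Nat.le_of_lt_succ hlt)
  obtain ⟨x, hx, hxy⟩ := Set.exists_ne_of_one_lt_ncard hK y
  obtain ⟨x', hx', hxy'⟩ := Set.exists_ne_of_one_lt_ncard hK' y
  obtain ⟨w⟩ := (h.2.2 y).preconnected ⟨x, hxy⟩ ⟨x', hxy'⟩
  obtain ⟨⟨⟨a, b⟩, hab⟩, -, ha, hb⟩ :=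
    w.exists_boundary_dart (Subtype.val ⁻¹' verts K) hx fun hx'K => hxy' (hy ⟨hx'K, hx'⟩)
  obtain ⟨e, he, hends⟩ := adj_iff_exists_mem_edges.1 hab
  by_cases heK : e ∈ K
  · exact hb (mem_verts_right heK hends)
  · exact a.2 (hy ⟨ha, mem_verts_left (Set.mem_sdiff_of_mem he heK) hends⟩)

theorem DirectionBalanced.three_le_ncard_inter (hbal : G.DirectionBalanced)
    (hconn : G.TwoConnected) (hKE : K ⊆ G.edges) (hK : 3 ≤ (verts K).ncard)
    (hK' : 3 ≤ (verts (G.edges \ K)).ncard) (hdir : ∀ e ∈ K, ¬ e.IsDir) :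
    3 ≤ (verts K ∩ verts (G.edges \ K)).ncard := by
  by_contra! hlt
  have hle := hconn.two_le_ncard_inter (K := K) (by omega) (by omega)
  obtain ⟨u, v, huv, hinter⟩ := Set.ncard_eq_two.1 (hle.antisymm' (Nat.le_of_lt_succ hlt))
  have hsdiff {A B : Set V} (hA : 3 ≤ A.ncard) (hAB : (A ∩ B).ncard < 3) : (A \ B).Nonempty :=
    Set.sdiff_nonempty.2 fun h => (hAB.trans_le hA).ne (by rw [Set.inter_eq_left.2 h])
  obtain ⟨⟨s, hs, -⟩, -⟩ := hbal _ _ u v huv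
    (isUnion_ofEdges hKE (hconn.verts_union_verts_sdiff K)) hinter (hsdiff hK hlt)
    (hsdiff hK' (by rwa [Set.inter_comm]))
  rw [Subgraph.ofEdges, SimpleGraph.edgeSet_fromEdgeSet] at hs
  exact hdir _ hs.1 ⟨s, rfl⟩

end MixedGraph

namespace MixedGraph

open MixedEdge

variable {V : Type*} [Finite V] {G : MixedGraph V} {e : MixedEdge V}

theorem RedundantlyRigid.exists_isCircuit (hR : G.RedundantlyRigid) (he : e ∈ G.edges) :
    ∃ C, G.rigidityMatroid.IsCircuit C ∧ e ∈ C := by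
  obtain ⟨p, hp, hrigid⟩ := hR
  rw [← mem_closure_edges_sdiff_singleton_iff hp he, ← edges_deleteEdge]
  exact (hrigid e he).mem_closure_edges hp e

theorem exists_isCircuit_subset_circuitComponent
    (hcircuit : ∀ e ∈ G.edges, ∃ C, G.rigidityMatroid.IsCircuit C ∧ e ∈ C) (he : e ∈ G.edges) :
    ∃ C ⊆ circuitComponent G.rigidityMatroid e, G.rigidityMatroid.IsCircuit C := by
  obtain ⟨C, hC, heC⟩ := hcircuit e he
  exact ⟨C, subset_circuitComponent_of_isCircuit hC heC (mem_circuitComponent_self he), hC⟩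

theorem three_le_ncard_verts_of_isCircuit {C : Set (MixedEdge V)}
    (hC : G.rigidityMatroid.IsCircuit C) : 3 ≤ (verts C).ncard := by
  obtain ⟨p, hp⟩ := exists_isGeneric V
  exact hp.genericConfig.three_le_ncard_verts_of_isCircuit
    ((isCircuit_rigidityMatroid_iff hp).1 hC).1
    fun _ he => not_isDiag_of_mem_edges (hC.subset_ground he)

section Base

variable {B : Set (MixedEdge V)}

theorem circuitComponent_subset_closure_constraintMatroid (hB : G.rigidityMatroid.IsBase B)
    {p : V → Plane} (hp : IsGeneric p) (e : MixedEdge V) : circuitComponent G.rigidityMatroid e ⊆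
      (constraintMatroid (toComplex ∘ p)).closure (B ∩ circuitComponent G.rigidityMatroid e) := by
  have hsub := circuitComponent_subset_closure_of_isBase hB e
  have hE : B ∩ circuitComponent G.rigidityMatroid e ⊆ G.edges :=
    Set.inter_subset_left.trans hB.subset_ground
  rw [G.rigidityMatroid_eq hp] at hsub hE ⊢
  rw [Matroid.restrict_closure_eq _ hE (Set.subset_univ _)] at hsub
  exact hsub.trans Set.inter_subset_left

theorem two_mul_ncard_verts_circuitComponent_le_add_three (hB : G.rigidityMatroid.IsBase B)
    (he : e ∈ G.edges) : 2 * (verts (circuitComponent G.rigidityMatroid e)).ncard ≤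
      (B ∩ circuitComponent G.rigidityMatroid e).ncard + 3 := by
  obtain ⟨p, hp⟩ := exists_isGeneric V
  exact (isSimilarityRigid_circuitComponent hp he).two_mul_ncard_verts_le_add_three hp.genericConfig
    (mem_circuitComponent_self he) (not_isDiag_of_mem_edges he)
    (circuitComponent_subset_closure_constraintMatroid hB hp e)

theorem two_mul_ncard_verts_circuitComponent_le_add_two (hB : G.rigidityMatroid.IsBase B)
    (he : e ∈ G.edges) {f g : MixedEdge V} (hf : f ∈ circuitComponent G.rigidityMatroid e)
    (hg : g ∈ circuitComponent G.rigidityMatroid e) (hfd : f.IsDir) (hgd : ¬ g.IsDir) :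
    2 * (verts (circuitComponent G.rigidityMatroid e)).ncard ≤
      (B ∩ circuitComponent G.rigidityMatroid e).ncard + 2 := by
  obtain ⟨p, hp⟩ := exists_isGeneric V
  exact (isSimilarityRigid_circuitComponent hp he).two_mul_ncard_verts_le_add_two hp.genericConfig
    hf hg (not_isDiag_of_mem_edges hf.1) (not_isDiag_of_mem_edges hg.1) (unit_ne_of_isDir hfd hgd)
    (circuitComponent_subset_closure_constraintMatroid hB hp e)

theorem ncard_add_two_le_of_isBase [Nonempty V] (hB : G.rigidityMatroid.IsBase B) :
    B.ncard + 2 ≤ 2 * Nat.card V := by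
  obtain ⟨p, hp⟩ := exists_isGeneric V
  have hind := hB.indep
  rw [G.rigidityMatroid_eq hp, Matroid.restrict_indep_iff, linearMatroid_indep] at hind
  rw [← Set.ncard_univ]
  exact ncard_add_two_le_of_linearIndepOn hind.1 Set.univ_nonempty (Set.subset_univ _)

theorem three_le_ncard_verts_sdiff_circuitComponent
    (hcircuit : ∀ e ∈ G.edges, ∃ C, G.rigidityMatroid.IsCircuit C ∧ e ∈ C) (hM : ¬ G.MConnected)
    (e : MixedEdge V) :
    3 ≤ (verts (G.edges \ circuitComponent G.rigidityMatroid e)).ncard := by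
  obtain ⟨f, hf, hfe⟩ := Set.exists_of_ssubset <| (circuitComponent_subset_ground _ e).ssubset_of_ne
    (mt isConnected_of_circuitComponent_eq_ground hM)
  obtain ⟨C, hC, hfC⟩ := hcircuit f hf
  refine (three_le_ncard_verts_of_isCircuit hC).trans (Set.ncard_le_ncard (verts_mono ?_))
  exact fun g hg => ⟨hC.subset_ground hg,
    fun hge => hfe (subset_circuitComponent_of_isCircuit hC hg hge hfC)⟩

theorem two_mul_ncard_verts_circuitComponent_le (hred : ¬ ∃ e, G.EdgeReduction e)
    (hconn : G.TwoConnected) (hbal : G.DirectionBalanced)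
    (hcircuit : ∀ e ∈ G.edges, ∃ C, G.rigidityMatroid.IsCircuit C ∧ e ∈ C) (hM : ¬ G.MConnected)
    (hB : G.rigidityMatroid.IsBase B) {K : Set (MixedEdge V)}
    (hK : K ∈ circuitComponent G.rigidityMatroid '' G.edges) :
    2 * (verts K).ncard ≤ (B ∩ K).ncard + (verts K ∩ verts (G.edges \ K)).ncard := by
  obtain ⟨e, he, rfl⟩ := hK
  obtain ⟨C, hCK, hC⟩ := exists_isCircuit_subset_circuitComponent hcircuit he
  have hK : 3 ≤ (verts (circuitComponent G.rigidityMatroid e)).ncard :=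
    (three_le_ncard_verts_of_isCircuit hC).trans (Set.ncard_le_ncard (verts_mono hCK))
  have hK' := three_le_ncard_verts_sdiff_circuitComponent hcircuit hM e
  by_cases hdir : ∃ f ∈ circuitComponent G.rigidityMatroid e, f.IsDir
  · obtain ⟨f, hf, hfd⟩ := hdir
    obtain ⟨g, hg, hgd⟩ := exists_not_isDir_of_isCircuit hred hC
    exact (two_mul_ncard_verts_circuitComponent_le_add_two hB he hf (hCK hg) hfd hgd).trans
      (Nat.add_le_add_left (hconn.two_le_ncard_inter (by omega) (by omega)) _)
  · exact (two_mul_ncard_verts_circuitComponent_le_add_three hB he).trans <| Nat.add_le_add_left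
      (hbal.three_le_ncard_inter hconn (circuitComponent_subset_ground _ e) hK hK'
        fun f hf hfd => hdir ⟨f, hf, hfd⟩) _

end Base

theorem verts_sdiff_subset_of_coe_eq {s : Finset (Set (MixedEdge V))}
    (hs : (s : Set (Set (MixedEdge V))) = circuitComponent G.rigidityMatroid '' G.edges)
    (K : Set (MixedEdge V)) :
    verts (G.edges \ K) ⊆ {v | ∃ K' ∈ s, K' ≠ K ∧ v ∈ verts K'} := by
  rintro v ⟨e, ⟨he, heK⟩, hv⟩
  have he' : e ∈ circuitComponent G.rigidityMatroid e := mem_circuitComponent_self he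
  exact ⟨_, Finset.mem_coe.1 (hs ▸ Set.mem_image_of_mem _ he), fun h => heK (h ▸ he'), e, he', hv⟩

theorem TwoConnected.iUnion_verts_eq_univ (h : G.TwoConnected) {s : Finset (Set (MixedEdge V))}
    (hs : (s : Set (Set (MixedEdge V))) = circuitComponent G.rigidityMatroid '' G.edges) :
    ⋃ K ∈ s, verts K = Set.univ := by
  refine Set.eq_univ_of_forall fun v => ?_
  obtain ⟨e, he, hv⟩ := h.exists_mem_edges v
  have he' : e ∈ circuitComponent G.rigidityMatroid e := mem_circuitComponent_self he
  exact Set.mem_biUnion (Finset.mem_coe.1 (hs ▸ Set.mem_image_of_mem _ he)) ⟨e, he', hv⟩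

theorem mConnected_of_forall_exists_isCircuit
    (hcircuit : ∀ e ∈ G.edges, ∃ C, G.rigidityMatroid.IsCircuit C ∧ e ∈ C)
    (hred : ¬ ∃ e, G.EdgeReduction e) (hconn : G.TwoConnected) (hbal : G.DirectionBalanced) :
    G.MConnected := by
  by_contra hM
  have := hconn.nontrivial
  obtain ⟨B, hB⟩ := G.rigidityMatroid.exists_isBase
  obtain ⟨s, hs⟩ := (Set.toFinite (circuitComponent G.rigidityMatroid '' G.edges)).exists_finset_coe
  have hcomponent : ∀ K ∈ s, 2 * (verts K).ncard ≤
      (B ∩ K).ncard + (verts K ∩ {v | ∃ K' ∈ s, K' ≠ K ∧ v ∈ verts K'}).ncard := fun K hK =>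
    (two_mul_ncard_verts_circuitComponent_le hred hconn hbal hcircuit hM hB
      (hs ▸ Finset.mem_coe.2 hK)).trans (Nat.add_le_add_left (Set.ncard_le_ncard
        (Set.inter_subset_inter_right _ (verts_sdiff_subset_of_coe_eq hs K))) _)
  have hsum := Finset.sum_le_sum hcomponent
  rw [Finset.sum_add_distrib, ← ncard_eq_sum_ncard_inter_circuitComponent hB.subset_ground hs]
    at hsum
  have hcover := two_mul_card_add_sum_ncard_inter_le (hconn.iUnion_verts_eq_univ hs)
  have hrank := ncard_add_two_le_of_isBase hB
  omega

end MixedGraph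

theorem mainTheorem8_general {V : Type*} [Finite V] (G : MixedGraph V) (hD : G.D ≠ ⊥)
    (hred : ¬ ∃ e, G.EdgeReduction e) (hconn : G.TwoConnected) (hbal : G.DirectionBalanced) :
    G.MConnected ↔ G.RedundantlyRigid :=
  ⟨fun hM => hM.redundantlyRigid hD hred hconn,
    fun hR => G.mConnected_of_forall_exists_isCircuit (fun _ => hR.exists_isCircuit)
      hred hconn hbal⟩

theorem mainTheorem8 {V : Type*} [Finite V] (G : MixedGraph V) (hD : G.D ≠ ⊥)
    (hirr : G.DirectionIrreducible) (hconn : G.TwoConnected) (hbal : G.DirectionBalanced) :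
    G.MConnected ↔ G.RedundantlyRigid :=
  mainTheorem8_general G hD hirr.1 hconn hbal
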